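/- A rack is a set $X$ with a binary operation $\triangleright$ such that $t\triangleright(s\triangleright r)=(t\triangleright s)\triangleright(t\triangleright r)$ for all $t,s,r$ and such that every map $g_t\colon X\to X$, $s\mapsto t\triangleright s$, is bijective; it is a quandle if moreover $t\triangleright t=t$ for all $t$. The inner group $\operatorname{Inn}X$ is the group of permutations of $X$ generated by the $g_t$. The rack $X$ is indecomposable if $\operatorname{Inn}X$ acts transitively on $X$, and faithful if $t\mapsto g_t$ is injective. For indecomposable $X$, the degree $\deg X$ is the common order of the $g_t$. A subrack is a subset closed under $\triangleright$ and under the inverse operations. Let $X$ be a finite indecomposable faithful quandle, $\mathbb K$ a field of arbitrary characteristic, and $\chi\colon X\times X\to\mathbb K^\times$ a rack 2-cocycle, i.e. $\chi(t,s\triangleright r)\,\chi(s,r)=\chi(t\triangleright s,t\triangleright r)\,\chi(t,r)$ for all $t,s,r\in X$. Its order $m$ is the least $m\ge 1$ with $\chi(t,t)^m=1$ for all $t\in X$ (and $\infty$ if there is none). Let $V=\mathbb K X$ with basis $(e_t)_{t\in X}$, let $g_t$ act on $V$ by $g_t(e_s)=\chi(t,s)\,e_{t\triangleright s}$ and on the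 tensor algebra $TV$ by algebra automorphisms, and let $c(e_t\otimes w)=g_t(w)\otimes e_t$ be the corresponding braiding. Let $\Delta\colon TV\to TV\otimes TV$ be the unique comultiplication for which the $e_t$ are primitive and which is an algebra map into the tensor square with the multiplication $(\mu\otimes\mu)(\mathrm{id}\otimes c\otimes\mathrm{id})$. The Nichols algebra is $\mathfrak B=TV/I$, where $I$ is the largest homogeneous two-sided ideal of $TV$ with $\Delta(I)\subseteq I\otimes TV+TV\otimes I$ whose non-zero homogeneous elements all have degree $\ge 2$. The braided derivations $\partial_t\colon\mathfrak B\to\mathfrak B$ ($t\in X$) are defined by $$\Delta(v)\in v\otimes 1+\sum_{t\in X}\partial_t(v)\otimes e_t+\mathfrak B\otimes\bigoplus_{j\ge2}\mathfrak B(j).$$ For $g\in\operatorname{Inn}X$ let $\mathfrak B(g)\subseteq\mathfrak B$ be the span of all monomials $e_{t_1}\cdots e_{t_k}$ with $g_{t_1}\cdots g_{t_k}=g$; let $e$ be the neutral element of $\operatorname{Inn}X$. Theorem. Assume that $\mathfrak B$ is finite-dimensional and that $n=\deg X$ divides the order $m$ of $\chi$. Let $X'$ be a non-empty proper subrack of $X$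 such that $\{g_s : s\in X\setminus X'\}$ still generates $\operatorname{Inn}X$, and let $\mathfrak B'$ be the unital subalgebra of $\mathfrak B$ generated by the $e_t$ with $t\in X'$. Then $$\dim\mathfrak B=\#\operatorname{Inn}X\cdot\dim\mathfrak B'\cdot\dim\Bigl(\mathfrak B(e)\cap\bigcap_{t\in X'}\ker\partial_t\Bigr).$$ In particular, $\#\operatorname{Inn}X\cdot\dim\mathfrak B'$ divides $\dim\mathfrak B$. -/

import Mathlib

open scoped TensorProduct Quandles

noncomputable section

namespace RackNichols

/-! ### Racks -/

section Racks

variable (X : Type*) [Rack X]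

/-- The inner group `Inn X`: the permutation group of `X` generated by all
`g_t : s ↦ t ◃ s`. -/
def Inn : Subgroup (Equiv.Perm X) :=
  Subgroup.closure (Set.range fun t : X => (Rack.act' t : Equiv.Perm X))

variable {X}

/-- The permutation `g_t : s ↦ t ◃ s` as an element of `Inn X`. -/
def innGen (t : X) : Inn X :=
  ⟨Rack.act' t, Subgroup.subset_closure ⟨t, rfl⟩⟩

variable (X)

/-- `X` is indecomposable: `Inn X` acts transitively on `X`. -/
def Indecomposable : Prop :=
  MulAction.IsPretransitive (Inn X) X

/-- `X` is faithful: `t ↦ g_t` is injective. -/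
def Faithful : Prop :=
  Function.Injective (innGen : X → Inn X)

/-- The degree of `X`: the least `n ≥ 1` with `g_t ^ n = 1` for all `t` (and `0` if there is none).
For an indecomposable rack this is the order of each single `g_t`,
see `orderOf_innGen_eq_degree`. -/
def degree : ℕ :=
  orderOf (fun t : X => innGen t)

variable {X}

theorem innGen_act (s t : X) : innGen (s ◃ t) = innGen s * innGen t * (innGen s)⁻¹ :=
  Subtype.ext (Rack.ad_conj s t)

theorem innGen_smul (g : Inn X) (t : X) : innGen (g • t) = g * innGen t * g⁻¹ := by
  obtain ⟨g, hg⟩ := g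
  induction hg using Subgroup.closure_induction generalizing t with
  | mem x hx =>
    obtain ⟨s, rfl⟩ := hx
    exact innGen_act s t
  | one =>
    have : (⟨1, Subgroup.one_mem _⟩ : Inn X) = 1 := rfl
    simp [this]
  | mul x y hx hy ihx ihy =>
    have h : (⟨x * y, Subgroup.mul_mem _ hx hy⟩ : Inn X) = ⟨x, hx⟩ * ⟨y, hy⟩ := rfl
    rw [h, mul_smul, ihx, ihy]
    group
  | inv x hx ih =>
    have h : (⟨x⁻¹, Subgroup.inv_mem _ hx⟩ : Inn X) = (⟨x, hx⟩ : Inn X)⁻¹ := rfl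
    have h2 := ih ((⟨x, hx⟩ : Inn X)⁻¹ • t)
    rw [smul_inv_smul] at h2
    rw [h, h2]
    group

/-- In an indecomposable rack all `g_t` have the same order, namely `degree X`. -/
theorem orderOf_innGen_eq_degree (h : Indecomposable X) (t : X) :
    orderOf (innGen t) = degree X := by
  have key : ∀ s : X, orderOf (innGen s) = orderOf (innGen t) := by
    intro s
    obtain ⟨g, rfl⟩ := h.exists_smul_eq t s
    rw [innGen_smul]
    exact orderOf_injective (MulAut.conj g).toMonoidHom (MulAut.conj g).injective (innGen t)
  refine Nat.dvd_antisymm ?_ ?_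
  · refine orderOf_dvd_of_pow_eq_one ?_
    exact congrFun (pow_orderOf_eq_one (fun t : X => innGen t)) t
  · refine orderOf_dvd_of_pow_eq_one (funext fun s => ?_)
    show innGen s ^ _ = 1
    rw [← key s, pow_orderOf_eq_one]

/-- A subset of `X` is a subrack if it is closed under the operation of `X` and its inverse. -/
def IsSubrack (Y : Set X) : Prop :=
  ∀ s ∈ Y, ∀ t ∈ Y, s ◃ t ∈ Y ∧ s ◃⁻¹ t ∈ Y

end Racks

/-! ### Cocycles and the tensor algebra -/

/-- A rack 2-cocycle on `X` with values in `Kˣ`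
(i.e. the case of a one-dimensional coefficient space). -/
structure Cocycle (X K : Type*) [Rack X] [Field K] where
  /-- the underlying function of the cocycle -/
  toFun : X → X → Kˣ
  cocycle : ∀ t s r : X,
    toFun t (s ◃ r) * toFun s r = toFun (t ◃ s) (t ◃ r) * toFun t r

set_option linter.unusedSectionVars false

variable {X K : Type*} [Rack X] [Field K]

/-- The order of a cocycle: the least `m ≥ 1` with `χ(t,t) ^ m = 1` for all `t`
(and `0` if there is none). -/
def Cocycle.order (χ : Cocycle X K) : ℕ :=
  orderOf (fun t : X => χ.toFun t t)

/-- The action of `g_t` on `V = K X`: `e_s ↦ χ(t,s) e_{t ◃ s}`. -/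
def Cocycle.actV (χ : Cocycle X K) (t : X) : (X →₀ K) →ₗ[K] (X →₀ K) :=
  Finsupp.linearCombination K fun s => Finsupp.single (t ◃ s) (χ.toFun t s : K)

variable (X K) in
/-- The tensor algebra `TV` of `V = K X`. -/
abbrev TV : Type _ := TensorAlgebra K (X →₀ K)

variable (K) in
/-- The generator `e_t` of `TV`. -/
def gen (t : X) : TV X K :=
  TensorAlgebra.ι K (Finsupp.single t 1)

/-- The action of `g_t` on `TV` by algebra endomorphisms. -/
def Cocycle.actT (χ : Cocycle X K) (t : X) : TV X K →ₐ[K] TV X K :=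
  TensorAlgebra.lift K (TensorAlgebra.ι K ∘ₗ χ.actV t)

/-- The operator of left multiplication by `1 ⊗ u` on the braided tensor square `TV ⊗ TV`. It is
multiplicative in `u`, and `(1 ⊗ e_t) * (a ⊗ b) = g_t(a) ⊗ e_t b`.
-/
def Cocycle.oneTmulMul (χ : Cocycle X K) : TV X K →ₐ[K] Module.End K (TV X K ⊗[K] TV X K) :=
  TensorAlgebra.lift K <| Finsupp.linearCombination K fun t =>
    TensorProduct.map (χ.actT t).toLinearMap (LinearMap.mulLeft K (gen K t))

/-- The braiding `c` of `TV`, with `c (e_t ⊗ w) = g_t(w) ⊗ e_t`, extended multiplicatively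
to all of `TV ⊗ TV`: `c (t₁⋯t_k ⊗ w) = g_{t₁}⋯g_{t_k}(w) ⊗ t₁⋯t_k`. -/
def Cocycle.braiding (χ : Cocycle X K) : TV X K ⊗[K] TV X K →ₗ[K] TV X K ⊗[K] TV X K :=
  TensorProduct.lift <|
    (LinearMap.lcomp K _ ((TensorProduct.mk K (TV X K) (TV X K)).flip 1)) ∘ₗ
      χ.oneTmulMul.toLinearMap

/-- The multiplication `(μ ⊗ μ) (id ⊗ c ⊗ id)` of the braided tensor square,
`(a ⊗ u) * z = (a ⊗ 1) * ((1 ⊗ u) * z)`; see `braidedMul_tmul_tmul`. -/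
def Cocycle.braidedMul (χ : Cocycle X K) :
    (TV X K ⊗[K] TV X K) →ₗ[K] Module.End K (TV X K ⊗[K] TV X K) :=
  TensorProduct.lift <|
    ((LinearMap.mul K (Module.End K (TV X K ⊗[K] TV X K))).compl₁₂
      ((Module.End.rTensorAlgHom K (TV X K) (TV X K)).toLinearMap ∘ₗ
        (Algebra.lmul K (TV X K)).toLinearMap)
      χ.oneTmulMul.toLinearMap)

/-- The comultiplication of `TV`: the unique linear map that is multiplicative for the braided
tensor square and makes all `e_t` primitive, see `comul_one`, `comul_gen`, `comul_mul`. -/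
def Cocycle.comul (χ : Cocycle X K) : TV X K →ₗ[K] TV X K ⊗[K] TV X K :=
  LinearMap.applyₗ ((1 : TV X K) ⊗ₜ[K] (1 : TV X K)) ∘ₗ
    (TensorAlgebra.lift K (Finsupp.linearCombination K fun t : X =>
      χ.braidedMul (gen K t ⊗ₜ[K] 1 + 1 ⊗ₜ[K] gen K t))).toLinearMap

theorem actT_gen (χ : Cocycle X K) (t s : X) :
    χ.actT t (gen K s) = (χ.toFun t s : K) • gen K (t ◃ s) := by
  simp [Cocycle.actT, Cocycle.actV, gen, ← map_smul]

theorem oneTmulMul_gen (χ : Cocycle X K) (t : X) (a b : TV X K) :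
    χ.oneTmulMul (gen K t) (a ⊗ₜ[K] b) = χ.actT t a ⊗ₜ[K] (gen K t * b) := by
  simp [Cocycle.oneTmulMul, gen]

theorem TV_induction {P : TV X K → Prop} (one : P 1) (add : ∀ v w, P v → P w → P (v + w))
    (smul : ∀ (k : K) v, P v → P (k • v)) (mul : ∀ t v, P v → P (gen K t * v)) (v : TV X K) :
    P v := by
  have main : ∀ u v : TV X K, P v → P (u * v) := by
    intro u
    induction u using TensorAlgebra.induction with
    | algebraMap r =>
      intro v hv
      rw [← Algebra.smul_def]
      exact smul r v hv
    | ι x =>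
      intro v hv
      induction x using Finsupp.induction_linear with
      | zero =>
        have := smul 0 v hv
        simpa using this
      | add f g hf hg =>
        rw [map_add, add_mul]
        exact add _ _ hf hg
      | single t k =>
        have h : TensorAlgebra.ι K (Finsupp.single t k) = k • gen K t := by
          rw [gen, ← map_smul, Finsupp.smul_single_one]
        rw [h, smul_mul_assoc]
        exact smul k _ (mul t v hv)
    | mul a b ha hb =>
      intro v hv
      rw [mul_assoc]
      exact ha _ (hb _ hv)
    | add a b ha hb =>
      intro v hv
      rw [add_mul]
      exact add _ _ (ha _ hv) (hb _ hv)
  have h := main v 1 one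
  rwa [mul_one] at h

theorem braiding_gen (χ : Cocycle X K) (t : X) (w : TV X K) :
    χ.braiding (gen K t ⊗ₜ[K] w) = χ.actT t w ⊗ₜ[K] gen K t := by
  simp [Cocycle.braiding, oneTmulMul_gen]

theorem braidedMul_tmul (χ : Cocycle X K) (a u : TV X K) (z : TV X K ⊗[K] TV X K) :
    χ.braidedMul (a ⊗ₜ[K] u) z = (LinearMap.mulLeft K a).rTensor _ (χ.oneTmulMul u z) := by
  simp [Cocycle.braidedMul]
  rfl

theorem braidedMul_tmul_tmul (χ : Cocycle X K) (a u w b : TV X K) :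
    χ.braidedMul (a ⊗ₜ[K] u) (w ⊗ₜ[K] b) =
      TensorProduct.map (LinearMap.mulLeft K a) (LinearMap.mulRight K b)
        (χ.braiding (u ⊗ₜ[K] w)) := by
  have h : χ.oneTmulMul u (w ⊗ₜ[K] b) =
      (LinearMap.mulRight K b).lTensor _ (χ.braiding (u ⊗ₜ[K] w)) := by
    induction u using TV_induction with
    | one => simp [Cocycle.braiding]
    | add u v hu hv => simp [TensorProduct.add_tmul, map_add, hu, hv]
    | smul k u hu => simp [← TensorProduct.smul_tmul', map_smul, hu]
    | mul t u hu =>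
      have hc : χ.braiding ((gen K t * u) ⊗ₜ[K] w) =
          χ.oneTmulMul (gen K t) (χ.braiding (u ⊗ₜ[K] w)) := by
        simp [Cocycle.braiding]
      rw [map_mul, Module.End.mul_apply, hu, hc]
      generalize χ.braiding (u ⊗ₜ[K] w) = z
      induction z using TensorProduct.induction_on with
      | zero => simp
      | tmul x y => simp [oneTmulMul_gen, mul_assoc]
      | add x y hx hy => simp only [map_add, hx, hy]
  rw [braidedMul_tmul, h, ← LinearMap.comp_apply, LinearMap.rTensor_comp_lTensor]

theorem comul_one (χ : Cocycle X K) : χ.comul 1 = 1 ⊗ₜ[K] 1 := by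
  simp [Cocycle.comul]

theorem comul_gen_mul (χ : Cocycle X K) (t : X) (v : TV X K) :
    χ.comul (gen K t * v) =
      χ.braidedMul (gen K t ⊗ₜ[K] 1 + 1 ⊗ₜ[K] gen K t) (χ.comul v) := by
  simp [Cocycle.comul, gen]

theorem comul_gen (χ : Cocycle X K) (t : X) :
    χ.comul (gen K t) = gen K t ⊗ₜ[K] 1 + 1 ⊗ₜ[K] gen K t := by
  have h := comul_gen_mul χ t 1
  rw [mul_one, comul_one] at h
  rw [h, map_add, LinearMap.add_apply, braidedMul_tmul, braidedMul_tmul, oneTmulMul_gen]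
  simp

theorem braidedMul_gen_assoc (χ : Cocycle X K) (t : X) (y z : TV X K ⊗[K] TV X K) :
    χ.braidedMul (χ.braidedMul (gen K t ⊗ₜ[K] 1 + 1 ⊗ₜ[K] gen K t) y) z =
      χ.braidedMul (gen K t ⊗ₜ[K] 1 + 1 ⊗ₜ[K] gen K t) (χ.braidedMul y z) := by
  induction y using TensorProduct.induction_on with
  | zero => simp
  | add x y hx hy => simp only [map_add, LinearMap.add_apply] at hx hy ⊢; rw [hx, hy]
  | tmul a u =>
    have h1 : χ.braidedMul (gen K t ⊗ₜ[K] 1 + 1 ⊗ₜ[K] gen K t) (a ⊗ₜ[K] u) =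
        (gen K t * a) ⊗ₜ[K] u + χ.actT t a ⊗ₜ[K] (gen K t * u) := by
      rw [map_add, LinearMap.add_apply, braidedMul_tmul, braidedMul_tmul, oneTmulMul_gen]
      simp
    rw [h1]
    simp only [map_add, LinearMap.add_apply, braidedMul_tmul, map_mul, map_one,
      Module.End.mul_apply, Module.End.one_apply]
    generalize χ.oneTmulMul u z = y
    induction y using TensorProduct.induction_on with
    | zero => simp
    | tmul x y => simp [oneTmulMul_gen]
    | add x y hx hy =>
      simp only [map_add] at hx hy ⊢
      rw [add_add_add_comm, hx, hy, add_add_add_comm]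

/-- `Δ μ = (μ ⊗ μ) (id ⊗ c ⊗ id) (Δ ⊗ Δ)`. -/
theorem comul_mul (χ : Cocycle X K) (v w : TV X K) :
    χ.comul (v * w) = χ.braidedMul (χ.comul v) (χ.comul w) := by
  induction v using TV_induction with
  | one => rw [one_mul, comul_one, braidedMul_tmul]; simp
  | add u v hu hv => simp only [add_mul, map_add, LinearMap.add_apply, hu, hv]
  | smul k u hu => simp only [smul_mul_assoc, map_smul, LinearMap.smul_apply, hu]
  | mul t u hu =>
    rw [mul_assoc, comul_gen_mul, hu, comul_gen_mul, braidedMul_gen_assoc]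

/-! ### The Nichols algebra -/

variable (X K) in
/-- The component of degree `d` of `TV`. -/
abbrev homog (d : ℕ) : Submodule K (TV X K) :=
  LinearMap.range (TensorAlgebra.ι K : (X →₀ K) →ₗ[K] TV X K) ^ d

/-- For a subspace `J` of `TV`, the subspace `J ⊗ TV + TV ⊗ J` of `TV ⊗ TV`. -/
def tensorSum (J : Submodule K (TV X K)) : Submodule K (TV X K ⊗[K] TV X K) :=
  LinearMap.range (J.subtype.rTensor (TV X K)) ⊔ LinearMap.range (J.subtype.lTensor (TV X K))

/-- The homogeneous two-sided ideals `J` of `TV` that satisfy `Δ(J) ⊆ J ⊗ TV + TV ⊗ J` and have no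
non-zero homogeneous elements of degree `< 2`. -/
structure IsNicholsIdeal (χ : Cocycle X K) (J : Ideal (TV X K)) : Prop where
  isTwoSided : J.IsTwoSided
  isHomogeneous : J.IsHomogeneous (homog X K)
  two_le : ∀ d, ∀ x ∈ J, x ∈ homog X K d → x ≠ 0 → 2 ≤ d
  comul_mem : ∀ x ∈ J, χ.comul x ∈ tensorSum (J.restrictScalars K)

/-- The largest ideal `I` as above, obtained as the sum of all of them;
see `isGreatest_nicholsIdeal`. -/
def nicholsIdeal (χ : Cocycle X K) : Ideal (TV X K) :=
  sSup {J | IsNicholsIdeal χ J}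

theorem nicholsIdeal_induction {χ : Cocycle X K} {P : TV X K → Prop}
    (mem : ∀ J, IsNicholsIdeal χ J → ∀ x ∈ J, P x) (zero : P 0)
    (add : ∀ x y, P x → P y → P (x + y)) {x : TV X K} (hx : x ∈ nicholsIdeal χ) : P x := by
  rw [nicholsIdeal, sSup_eq_iSup'] at hx
  exact Submodule.iSup_induction _ (motive := P) hx (fun J y hy => mem J.1 J.2 y hy) zero add

theorem le_nicholsIdeal {χ : Cocycle X K} {J : Ideal (TV X K)} (h : IsNicholsIdeal χ J) :
    J ≤ nicholsIdeal χ :=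
  le_sSup h

instance (χ : Cocycle X K) : (nicholsIdeal χ).IsTwoSided where
  mul_mem_of_left {a} b ha := by
    refine nicholsIdeal_induction (P := fun a => a * b ∈ nicholsIdeal χ) ?_ ?_ ?_ ha
    · intro J hJ x hx
      have := hJ.isTwoSided
      exact le_nicholsIdeal hJ (J.mul_mem_right b hx)
    · simp
    · intro x y hx hy
      rw [add_mul]
      exact Ideal.add_mem _ hx hy

theorem tensorSum_mono {J J' : Submodule K (TV X K)} (h : J ≤ J') :
    tensorSum J ≤ tensorSum J' := by
  have hs : J.subtype = J'.subtype ∘ₗ Submodule.inclusion h := rfl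
  refine sup_le_sup ?_ ?_
  · rw [hs, LinearMap.rTensor_comp]; exact LinearMap.range_comp_le_range _ _
  · rw [hs, LinearMap.lTensor_comp]; exact LinearMap.range_comp_le_range _ _

theorem comul_mem_of_mem_nicholsIdeal (χ : Cocycle X K) {x : TV X K} (hx : x ∈ nicholsIdeal χ) :
    χ.comul x ∈ tensorSum ((nicholsIdeal χ).restrictScalars K) := by
  refine nicholsIdeal_induction
    (P := fun x => χ.comul x ∈ tensorSum ((nicholsIdeal χ).restrictScalars K)) ?_ ?_ ?_ hx
  · intro J hJ x hx
    exact tensorSum_mono (J := J.restrictScalars K) (le_nicholsIdeal hJ) (hJ.comul_mem x hx)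
  · simp
  · intro x y hx hy
    rw [map_add]
    exact Submodule.add_mem _ hx hy

theorem proj_eq_zero_of_mem_nicholsIdeal (χ : Cocycle X K) {d : ℕ} (hd : d < 2) {x : TV X K}
    (hx : x ∈ nicholsIdeal χ) : GradedRing.proj (homog X K) d x = 0 := by
  refine nicholsIdeal_induction (P := fun x => GradedRing.proj (homog X K) d x = 0) ?_ ?_ ?_ hx
  · intro J hJ x hx
    by_contra h
    have := hJ.two_le d _ (hJ.isHomogeneous d hx) (SetLike.coe_mem _) h
    omega
  · simp
  · intro x y hx hy
    rw [map_add, hx, hy, add_zero]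

theorem isGreatest_nicholsIdeal (χ : Cocycle X K) :
    IsGreatest {J | IsNicholsIdeal χ J} (nicholsIdeal χ) := by
  refine ⟨⟨inferInstance, ?_, ?_, fun x hx => comul_mem_of_mem_nicholsIdeal χ hx⟩,
    fun J hJ => le_nicholsIdeal hJ⟩
  · intro d x hx
    change GradedRing.proj (homog X K) d x ∈ nicholsIdeal χ
    refine nicholsIdeal_induction
      (P := fun x => GradedRing.proj (homog X K) d x ∈ nicholsIdeal χ) ?_ ?_ ?_ hx
    · exact fun J hJ x hx => le_nicholsIdeal hJ (hJ.isHomogeneous d hx)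
    · simp
    · intro x y hx hy
      rw [map_add]
      exact Ideal.add_mem _ hx hy
  · intro d x hx hxd hx0
    by_contra hd
    refine hx0 ?_
    rw [← proj_eq_zero_of_mem_nicholsIdeal χ (not_le.1 hd) hx, GradedRing.proj_apply,
      DirectSum.decompose_of_mem_same _ hxd]

/-- The Nichols algebra of `V = K X` with the braiding given by the cocycle `χ`. -/
def NicholsAlgebra (χ : Cocycle X K) : Type _ :=
  TV X K ⧸ nicholsIdeal χ

instance (χ : Cocycle X K) : Ring (NicholsAlgebra χ) :=
  inferInstanceAs (Ring (TV X K ⧸ nicholsIdeal χ))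

instance (χ : Cocycle X K) : Algebra K (NicholsAlgebra χ) :=
  inferInstanceAs (Algebra K (TV X K ⧸ nicholsIdeal χ))

namespace NicholsAlgebra

variable (χ : Cocycle X K)

/-- The projection `TV → 𝔅`. -/
def π : TV X K →ₐ[K] NicholsAlgebra χ :=
  Ideal.Quotient.mkₐ K (nicholsIdeal χ)

/-- The element `e_t` of `𝔅`. -/
def e (t : X) : NicholsAlgebra χ :=
  π χ (gen K t)

/-- A linear map on `TV` that vanishes on the ideal descends to `𝔅`. -/
def descend {M : Type*} [AddCommGroup M] [Module K M] (f : TV X K →ₗ[K] M)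
    (hf : ∀ x ∈ nicholsIdeal χ, f x = 0) : NicholsAlgebra χ →ₗ[K] M :=
  ((nicholsIdeal χ).restrictScalars K).liftQ f hf ∘ₗ
    (Submodule.Quotient.restrictScalarsEquiv K (nicholsIdeal χ)).symm.toLinearMap

@[simp]
theorem descend_π {M : Type*} [AddCommGroup M] [Module K M] (f : TV X K →ₗ[K] M)
    (hf : ∀ x ∈ nicholsIdeal χ, f x = 0) (x : TV X K) : descend χ f hf (π χ x) = f x :=
  rfl

theorem π_eq_zero {x : TV X K} (hx : x ∈ nicholsIdeal χ) : π χ x = 0 :=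
  Ideal.Quotient.eq_zero_iff_mem.2 hx

/-- The comultiplication of `𝔅`, induced by the one of `TV`. -/
def comul : NicholsAlgebra χ →ₗ[K] NicholsAlgebra χ ⊗[K] NicholsAlgebra χ :=
  descend χ (TensorProduct.map (π χ).toLinearMap (π χ).toLinearMap ∘ₗ χ.comul) <| by
    intro x hx
    have hker : tensorSum ((nicholsIdeal χ).restrictScalars K) ≤
        LinearMap.ker (TensorProduct.map (π χ).toLinearMap (π χ).toLinearMap) := by
      have h0 : (π χ).toLinearMap ∘ₗ ((nicholsIdeal χ).restrictScalars K).subtype = 0 :=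
        LinearMap.ext fun y => π_eq_zero χ y.2
      refine sup_le ?_ ?_ <;> rw [LinearMap.range_le_ker_iff]
      · rw [LinearMap.map_comp_rTensor, h0, TensorProduct.map_zero_left]
      · rw [LinearMap.map_comp_lTensor, h0, TensorProduct.map_zero_right]
    exact hker (comul_mem_of_mem_nicholsIdeal χ hx)

/-- The coefficient of `e_t` in the component of degree one of an element of `𝔅`. -/
def coeff (t : X) : NicholsAlgebra χ →ₗ[K] K :=
  descend χ (Finsupp.lapply t ∘ₗ TensorAlgebra.ιInv ∘ₗ GradedAlgebra.proj (homog X K) 1) <| by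
    intro x hx
    have h : GradedAlgebra.proj (homog X K) 1 x = 0 :=
      proj_eq_zero_of_mem_nicholsIdeal χ one_lt_two hx
    rw [LinearMap.comp_apply, LinearMap.comp_apply, h, map_zero, map_zero]

/-- The braided derivation `∂_t` of `𝔅`: the image of `v` is the first tensor factor belonging
to `e_t` in `Δ(v) = v ⊗ 1 + ∑ t, ∂_t(v) ⊗ e_t + (terms in 𝔅 ⊗ ⨁ j ≥ 2, 𝔅(j))`. -/
def partialD (t : X) : NicholsAlgebra χ →ₗ[K] NicholsAlgebra χ :=
  (TensorProduct.rid K (NicholsAlgebra χ)).toLinearMap ∘ₗ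
    (coeff χ t).lTensor (NicholsAlgebra χ) ∘ₗ comul χ

/-- The component `𝔅(g)` of the `Inn X`-grading of `𝔅`: it is spanned by the monomials
`e_{t₁} ⋯ e_{t_k}` with `g_{t₁} ⋯ g_{t_k} = g`. -/
def component (g : Inn X) : Submodule K (NicholsAlgebra χ) :=
  Submodule.span K {b | ∃ l : List X, (l.map innGen).prod = g ∧ b = (l.map (e χ)).prod}

/-- The subalgebra (with one) of `𝔅` generated by the `e_t` with `t ∈ Y`. -/
def sub (Y : Set X) : Subalgebra K (NicholsAlgebra χ) :=
  Algebra.adjoin K (e χ '' Y)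

end NicholsAlgebra

end RackNichols
end

/-! The dimension formula combines two facts about the space A of elements of 𝔅 annihilated by all
`∂_t` with t ∈ X' (`invariants χ X'`).

(1) Multiplication A ⊗ 𝔅' → 𝔅 is bijective (`finrank_eq_finrank_invariants_mul`). Products of i
derivations from X' and products of i generators from X' are in perfect duality through (T, w) ↦ ε(T
w), where ε is the constant coefficient. The derivations act locally nilpotently and are linear over
left factors from A. Subtracting from v the elements T_j(v) b_j, for dual bases T_j, b_j in the top
degree, therefore writes v step by step as a member of A · 𝔅'. Applying derivations to a relation
with coefficients in 𝔅' shows that it is trivial.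

(2) A is graded by Inn X and all its components have the same dimension (`finrank_component_eq`).
For s ∉ X', A is stable under left multiplication f by e_s, and also under the left derivation d of
e_s, because left and right derivations commute. With q = χ(s,s) one has d f = 1 + q f d and f^m =
d^m = 0, which makes f + d^(m-1) injective (`qWeyl_shift_injective`). Here f shifts the degree by
g_s and d^(m-1) by g_s^(1-m), which is again g_s since n divides m. So A(g) embeds into A(g_s g),
and as these g_s generate the finite group Inn X, all dimensions agree.

The calculus of derivations on 𝔅 rests on `mem_nicholsIdeal`: the Nichols ideal consists of the
tensors all of whose iterated skew derivatives have zero constant coefficient. -/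

open scoped TensorProduct Quandles

noncomputable section

namespace RackNichols

set_option linter.unusedSectionVars false

section

variable {X K : Type*} [Rack X] [Field K]

/-! ### Constant and linear coefficients on the tensor algebra -/

variable (X K) in
/-- The constant coefficient of an element of `TV`. -/
def counitT : TV X K →ₐ[K] K :=
  TensorAlgebra.algebraMapInv

@[simp]
theorem counitT_gen (t : X) : counitT X K (gen K t) = 0 := by
  simp [counitT, TensorAlgebra.algebraMapInv, gen]

theorem gen_mem_homog (t : X) : gen K t ∈ homog X K 1 := by
  rw [homog, pow_one]
  exact ⟨_, rfl⟩

theorem proj_zero (v : TV X K) :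
    GradedAlgebra.proj (homog X K) 0 v = algebraMap K _ (counitT X K v) := by
  induction v using TV_induction with
  | one =>
    simp only [map_one]
    exact DirectSum.decompose_of_mem_same (homog X K) (i := 0) SetLike.GradedOne.one_mem
  | add v w hv hw => simp only [map_add, hv, hw]
  | smul k v hv => rw [map_smul, hv, map_smul, smul_eq_mul, map_mul, Algebra.smul_def]
  | mul t v hv =>
    rw [map_mul (counitT X K), counitT_gen, zero_mul, map_zero]
    exact DirectSum.coe_decompose_mul_of_left_mem_of_not_le _ (gen_mem_homog t) (by simp)

theorem proj_zero_gen_mul (t : X) (v : TV X K) :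
    GradedAlgebra.proj (homog X K) 0 (gen K t * v) = 0 := by
  rw [proj_zero, map_mul, counitT_gen, zero_mul, map_zero]

theorem proj_succ_one (i : ℕ) : GradedAlgebra.proj (homog X K) (i + 1) 1 = 0 :=
  DirectSum.decompose_of_mem_ne (homog X K) (i := 0) SetLike.GradedOne.one_mem (by simp)

theorem proj_succ_gen_mul (i : ℕ) (t : X) (v : TV X K) :
    GradedAlgebra.proj (homog X K) (i + 1) (gen K t * v) =
      gen K t * GradedAlgebra.proj (homog X K) i v := by
  rw [add_comm i 1]
  exact DirectSum.coe_decompose_mul_add_of_left_mem _ (gen_mem_homog t)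

variable (K) in
/-- The coefficient of `e_t` in the component of degree one of an element of `TV`. -/
def coeffT (t : X) : TV X K →ₗ[K] K :=
  Finsupp.lapply t ∘ₗ TensorAlgebra.ιInv ∘ₗ GradedAlgebra.proj (homog X K) 1

@[simp]
theorem coeffT_one (t : X) : coeffT K t 1 = 0 := by
  rw [coeffT, LinearMap.comp_apply, LinearMap.comp_apply, proj_succ_one, map_zero, map_zero]

theorem coeffT_gen_mul (t r : X) (v : TV X K) :
    coeffT K t (gen K r * v) = Finsupp.single r 1 t * counitT X K v := by
  rw [coeffT, LinearMap.comp_apply, LinearMap.comp_apply, proj_succ_gen_mul 0, proj_zero,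
    ← Algebra.commutes, ← Algebra.smul_def, map_smul, gen, TensorAlgebra.ι_leftInverse, map_smul,
    Finsupp.lapply_apply, smul_eq_mul, mul_comm]

variable (χ : Cocycle X K)

@[simp]
theorem counitT_actT (r : X) (v : TV X K) : counitT X K (χ.actT r v) = counitT X K v := by
  induction v using TV_induction with
  | one => simp
  | add v w hv hw => simp only [map_add, hv, hw]
  | smul k v hv => simp only [map_smul, hv]
  | mul t v hv => simp [actT_gen]

theorem single_act (r s t : X) :
    Finsupp.single (r ◃ s) (1 : K) (r ◃ t) = Finsupp.single s 1 t := by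
  classical
  simp [Finsupp.single_apply, Rack.left_cancel]

theorem single_mul_congr {r s : X} {a b : K} (h : r = s → a = b) :
    Finsupp.single r (1 : K) s * a = Finsupp.single r 1 s * b := by
  classical
  by_cases hrs : r = s
  · rw [h hrs]
  · simp [hrs]

theorem single_smul_congr {M : Type*} [AddCommGroup M] [Module K M] {r s : X} {a b : M}
    (h : r = s → a = b) :
    Finsupp.single r (1 : K) s • a = Finsupp.single r (1 : K) s • b := by
  classical
  by_cases hrs : r = s
  · rw [h hrs]
  · simp [hrs]

theorem coeffT_actT (r t : X) (v : TV X K) :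
    coeffT K (r ◃ t) (χ.actT r v) = (χ.toFun r t : K) * coeffT K t v := by
  induction v using TV_induction with
  | one => simp
  | add v w hv hw => simp only [map_add, hv, hw, mul_add]
  | smul k v hv => rw [map_smul, map_smul, map_smul, hv, smul_eq_mul, smul_eq_mul, mul_left_comm]
  | mul s v hv =>
    rw [map_mul, actT_gen, smul_mul_assoc, map_smul, coeffT_gen_mul, coeffT_gen_mul, single_act,
      counitT_actT, smul_eq_mul, mul_left_comm, mul_left_comm (χ.toFun r t : K)]
    exact single_mul_congr fun h => by rw [h]

/-- On generators this is exactly the cocycle condition together with self-distributivity. -/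
theorem actT_actT (r s : X) (v : TV X K) :
    χ.actT r (χ.actT s v) = χ.actT (r ◃ s) (χ.actT r v) := by
  induction v using TV_induction with
  | one => simp
  | add v w hv hw => simp only [map_add, hv, hw]
  | smul k v hv => simp only [map_smul, hv]
  | mul t v hv =>
    have h : (χ.toFun s t : K) * χ.toFun r (s ◃ t) =
        χ.toFun r t * χ.toFun (r ◃ s) (r ◃ t) := by
      have := χ.cocycle r s t
      rw [mul_comm, mul_comm (χ.toFun r t : K)]
      exact_mod_cast this
    simp only [map_mul, actT_gen, map_smul, hv, smul_smul, h]
    rw [Shelf.self_distrib (x := r) (y := s) (z := t)]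

/-! ### Skew derivations of the tensor algebra -/

theorem comul_gen_mul_eq (r : X) (v : TV X K) :
    χ.comul (gen K r * v) = (LinearMap.mulLeft K (gen K r)).rTensor _ (χ.comul v) +
      TensorProduct.map (χ.actT r).toLinearMap (LinearMap.mulLeft K (gen K r)) (χ.comul v) := by
  rw [comul_gen_mul, map_add, LinearMap.add_apply, braidedMul_tmul, braidedMul_tmul]
  generalize χ.comul v = z
  congr 1
  · simp
  · simp [Cocycle.oneTmulMul, gen]

/-- The right skew derivation `(id ⊗ e_t^*) Δ` of `TV`. -/
def skewD (t : X) : TV X K →ₗ[K] TV X K :=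
  (TensorProduct.rid K (TV X K)).toLinearMap ∘ₗ (coeffT K t).lTensor (TV X K) ∘ₗ χ.comul

/-- The left skew derivation `(e_t^* ⊗ id) Δ` of `TV`. -/
def leftD (t : X) : TV X K →ₗ[K] TV X K :=
  (TensorProduct.lid K (TV X K)).toLinearMap ∘ₗ (coeffT K t).rTensor (TV X K) ∘ₗ χ.comul

theorem lTensor_counitT_comul (v : TV X K) :
    TensorProduct.rid K _ ((counitT X K).toLinearMap.lTensor _ (χ.comul v)) = v := by
  induction v using TV_induction with
  | one => simp [comul_one]
  | add v w hv hw => simp only [map_add, hv, hw]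
  | smul k v hv => simp only [map_smul, hv]
  | mul t v hv =>
    rw [comul_gen_mul_eq]
    have h1 : ∀ z : TV X K ⊗[K] TV X K, TensorProduct.rid K _ ((counitT X K).toLinearMap.lTensor _
        ((LinearMap.mulLeft K (gen K t)).rTensor _ z +
        TensorProduct.map (χ.actT t).toLinearMap (LinearMap.mulLeft K (gen K t)) z)) =
        gen K t * TensorProduct.rid K _ ((counitT X K).toLinearMap.lTensor _ z) := by
      intro z
      induction z using TensorProduct.induction_on with
      | zero => simp
      | tmul x y => simp
      | add x y hx hy =>
        simp only [map_add, mul_add] at hx hy ⊢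
        rw [add_add_add_comm, hx, hy]
    rw [h1, hv]

theorem rTensor_counitT_comul (v : TV X K) :
    TensorProduct.lid K _ ((counitT X K).toLinearMap.rTensor _ (χ.comul v)) = v := by
  induction v using TV_induction with
  | one => simp [comul_one]
  | add v w hv hw => simp only [map_add, hv, hw]
  | smul k v hv => simp only [map_smul, hv]
  | mul t v hv =>
    rw [comul_gen_mul_eq]
    have h1 : ∀ z : TV X K ⊗[K] TV X K, TensorProduct.lid K _ ((counitT X K).toLinearMap.rTensor _
        ((LinearMap.mulLeft K (gen K t)).rTensor _ z +
        TensorProduct.map (χ.actT t).toLinearMap (LinearMap.mulLeft K (gen K t)) z)) =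
        gen K t * TensorProduct.lid K _ ((counitT X K).toLinearMap.rTensor _ z) := by
      intro z
      induction z using TensorProduct.induction_on with
      | zero => simp
      | tmul x y => simp
      | add x y hx hy =>
        simp only [map_add, mul_add] at hx hy ⊢
        rw [add_add_add_comm, hx, hy]
    rw [h1, hv]

@[simp]
theorem skewD_one (t : X) : skewD χ t 1 = 0 := by
  simp [skewD, comul_one]

@[simp]
theorem leftD_one (t : X) : leftD χ t 1 = 0 := by
  simp [leftD, comul_one]

theorem skewD_gen_mul (t r : X) (v : TV X K) :
    skewD χ t (gen K r * v) =
      gen K r * skewD χ t v + Finsupp.single r (1 : K) t • χ.actT r v := by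
  -- Writing v as (id ⊗ ε)Δ(v) makes both sides linear in Δ(v), so the identity can be checked on
  -- pure tensors.
  conv_rhs => enter [2, 2]; rw [← lTensor_counitT_comul χ v]
  simp only [skewD, LinearMap.comp_apply, comul_gen_mul_eq]
  generalize χ.comul v = z
  induction z using TensorProduct.induction_on with
  | zero => simp
  | tmul x y => simp [coeffT_gen_mul, smul_smul]
  | add x y hx hy =>
    simp only [map_add, mul_add, smul_add] at hx hy ⊢
    rw [add_add_add_comm, hx, hy, add_add_add_comm]

/-- Moving g_r past the functional dual to e_{r ◃ u} turns it into χ(r,u) times the one dual to e_u.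
Every index has the form r ◃ u because g_r is bijective, so this covers all left derivations. -/
theorem leftD_gen_mul (r u : X) (v : TV X K) :
    leftD χ (r ◃ u) (gen K r * v) =
      Finsupp.single r (1 : K) (r ◃ u) • v + (χ.toFun r u : K) • (gen K r * leftD χ u v) := by
  conv_rhs => enter [1]; rw [← rTensor_counitT_comul χ v]
  simp only [leftD, LinearMap.comp_apply, comul_gen_mul_eq]
  generalize χ.comul v = z
  induction z using TensorProduct.induction_on with
  | zero => simp
  | tmul x y => simp [coeffT_gen_mul, coeffT_actT, smul_smul]
  | add x y hx hy =>
    simp only [map_add, mul_add, smul_add] at hx hy ⊢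
    rw [add_add_add_comm, hx, hy, add_add_add_comm]

theorem skewD_actT (r t : X) (v : TV X K) :
    skewD χ (r ◃ t) (χ.actT r v) = (χ.toFun r t : K) • χ.actT r (skewD χ t v) := by
  induction v using TV_induction with
  | one => simp
  | add v w hv hw => simp only [map_add, hv, hw, smul_add]
  | smul k v hv => simp only [map_smul, hv]; rw [smul_comm]
  | mul s v hv =>
    simp only [map_mul, actT_gen, smul_mul_assoc, map_smul, skewD_gen_mul, hv, map_add, single_act,
      ← actT_actT, smul_add, mul_smul_comm]
    congr 1
    · rw [smul_comm]
    · rw [smul_comm, smul_comm (χ.toFun r t : K)]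
      exact single_smul_congr fun h => by rw [h]

theorem leftD_actT (r t : X) (v : TV X K) :
    leftD χ (r ◃ t) (χ.actT r v) = (χ.toFun r t : K) • χ.actT r (leftD χ t v) := by
  induction v using TV_induction generalizing t with
  | one => simp
  | add v w hv hw => simp only [map_add, hv, hw, smul_add]
  | smul k v hv => simp only [map_smul, hv]; rw [smul_comm]
  | mul s v hv =>
    obtain ⟨u, rfl⟩ : ∃ u, t = s ◃ u := ⟨s ◃⁻¹ t, by simp⟩
    have hc : (χ.toFun r s : K) * (χ.toFun (r ◃ s) (r ◃ u) * χ.toFun r u) =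
        χ.toFun r (s ◃ u) * (χ.toFun s u * χ.toFun r s) := by
      have : (χ.toFun r (s ◃ u) : K) * χ.toFun s u =
        χ.toFun (r ◃ s) (r ◃ u) * χ.toFun r u := by exact_mod_cast χ.cocycle r s u
      rw [← this]; ring
    rw [map_mul, actT_gen, smul_mul_assoc, map_smul, Shelf.self_distrib, leftD_gen_mul, hv,
      leftD_gen_mul, ← Shelf.self_distrib, single_act]
    simp only [map_mul, actT_gen, smul_mul_assoc, map_smul, map_add, smul_add, mul_smul_comm,
      smul_smul, hc]
    congr 1
    rw [mul_comm, mul_comm (χ.toFun r (s ◃ u) : K), mul_smul, mul_smul]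
    exact single_smul_congr fun h => by rw [← h]

/-- The two kinds of derivation act on opposite ends of Δ, so this is an instance of
coassociativity. It is what keeps the kernels of right derivations stable under left ones. -/
theorem leftD_skewD (s t : X) (v : TV X K) :
    leftD χ s (skewD χ t v) = skewD χ t (leftD χ s v) := by
  induction v using TV_induction generalizing s with
  | one => simp
  | add v w hv hw => simp only [map_add, hv, hw]
  | smul k v hv => simp only [map_smul, hv]
  | mul r v hv =>
    obtain ⟨u, rfl⟩ : ∃ u, s = r ◃ u := ⟨r ◃⁻¹ s, by simp⟩
    simp only [skewD_gen_mul, leftD_gen_mul, map_add, map_smul, hv, leftD_actT, smul_add]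
    rw [smul_comm (χ.toFun r u : K) (Finsupp.single r (1 : K) t)]
    abel

theorem skewD_mul (t : X) (v w : TV X K) :
    skewD χ t (v * w) = v * skewD χ t w + skewD χ t v * χ.actT t w := by
  induction v using TV_induction with
  | one => simp
  | add v v' hv hv' => simp only [map_add, hv, hv', add_mul]; abel
  | smul k v hv => simp only [map_smul, hv, smul_mul_assoc, smul_add]
  | mul r v hv =>
    rw [mul_assoc, skewD_gen_mul, hv, skewD_gen_mul]
    simp only [mul_add, add_mul, smul_mul_assoc, map_mul, mul_assoc]
    rw [add_assoc]
    congr 2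
    exact single_smul_congr fun h => by rw [h]

theorem comul_actT (r : X) (v : TV X K) :
    χ.comul (χ.actT r v) =
      TensorProduct.map (χ.actT r).toLinearMap (χ.actT r).toLinearMap (χ.comul v) := by
  induction v using TV_induction with
  | one => simp [comul_one]
  | add v w hv hw => simp only [map_add, hv, hw]
  | smul k v hv => simp only [map_smul, hv]
  | mul s v hv =>
    rw [map_mul, actT_gen, smul_mul_assoc, map_smul, comul_gen_mul_eq, comul_gen_mul_eq, hv]
    generalize χ.comul v = z
    induction z using TensorProduct.induction_on with
    | zero => simp
    | tmul x y =>
      simp [actT_gen, actT_actT χ r s, TensorProduct.smul_tmul']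
    | add x y hx hy =>
      simp only [map_add, smul_add] at hx hy ⊢
      rw [add_add_add_comm, hx, hy, add_add_add_comm]

/-- The part of coassociativity needed to show that `derivKer` is a coideal. -/
theorem lTensor_skewD_comul (t : X) (v : TV X K) :
    (skewD χ t).lTensor _ (χ.comul v) = χ.comul (skewD χ t v) := by
  induction v using TV_induction with
  | one => simp [comul_one]
  | add v w hv hw => simp only [map_add, hv, hw]
  | smul k v hv => simp only [map_smul, hv]
  | mul r v hv =>
    rw [skewD_gen_mul, map_add, map_smul, comul_actT, comul_gen_mul_eq, comul_gen_mul_eq, ← hv]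
    generalize χ.comul v = z
    induction z using TensorProduct.induction_on with
    | zero => simp
    | tmul x y => simp [skewD_gen_mul, TensorProduct.tmul_add, add_assoc]
    | add x y hx hy =>
      simp only [map_add, smul_add] at hx hy ⊢
      rw [add_add_add_comm, hx, hy]
      abel

theorem proj_actT (i : ℕ) (r : X) (v : TV X K) :
    GradedAlgebra.proj (homog X K) i (χ.actT r v) =
      χ.actT r (GradedAlgebra.proj (homog X K) i v) := by
  induction v using TV_induction generalizing i with
  | one =>
    cases i with
    | zero => rw [proj_zero, proj_zero, counitT_actT, AlgHom.commutes]
    | succ i => rw [map_one, proj_succ_one, map_zero]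
  | add v w hv hw => simp only [map_add, hv, hw]
  | smul k v hv => simp only [map_smul, hv]
  | mul t v hv =>
    rw [map_mul, actT_gen, smul_mul_assoc, map_smul]
    cases i with
    | zero => rw [proj_zero_gen_mul, proj_zero_gen_mul, smul_zero, map_zero]
    | succ i => rw [proj_succ_gen_mul, proj_succ_gen_mul, hv, map_mul, actT_gen, smul_mul_assoc]

theorem skewD_proj_zero (t : X) (v : TV X K) :
    skewD χ t (GradedAlgebra.proj (homog X K) 0 v) = 0 := by
  rw [proj_zero, Algebra.algebraMap_eq_smul_one, map_smul, skewD_one, smul_zero]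

theorem skewD_proj_succ (i : ℕ) (t : X) (v : TV X K) :
    skewD χ t (GradedAlgebra.proj (homog X K) (i + 1) v) =
      GradedAlgebra.proj (homog X K) i (skewD χ t v) := by
  induction v using TV_induction generalizing i with
  | one => rw [proj_succ_one, skewD_one, map_zero, map_zero]
  | add v w hv hw => simp only [map_add, hv, hw]
  | smul k v hv => simp only [map_smul, hv]
  | mul r v hv =>
    rw [proj_succ_gen_mul, skewD_gen_mul, skewD_gen_mul, map_add, map_smul, proj_actT]
    congr 1
    cases i with
    | zero => rw [skewD_proj_zero, proj_zero_gen_mul, mul_zero]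
    | succ i => rw [hv, proj_succ_gen_mul]

end

section

variable {X K : Type*} [Rack X] [Field K]

/-! ### The Nichols ideal in terms of skew derivations -/

variable (χ : Cocycle X K)

/-- The composite `∂_{t_k} ⋯ ∂_{t_1}` on `TV` for a list `[t_1, …, t_k]`. -/
def iterD : List X → TV X K →ₗ[K] TV X K
  | [] => LinearMap.id
  | t :: l => iterD l ∘ₗ skewD χ t

/-- The elements of `TV` all of whose iterated skew derivatives have vanishing constant
coefficient. -/
def derivKer : Submodule K (TV X K) :=
  ⨅ l : List X, LinearMap.ker ((counitT X K).toLinearMap ∘ₗ iterD χ l)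

theorem mem_derivKer {x : TV X K} :
    x ∈ derivKer χ ↔ ∀ l, counitT X K (iterD χ l x) = 0 := by
  simp [derivKer]

theorem counitT_of_mem_derivKer {x : TV X K} (hx : x ∈ derivKer χ) : counitT X K x = 0 :=
  (mem_derivKer χ).1 hx []

theorem skewD_mem_derivKer {x : TV X K} (hx : x ∈ derivKer χ) (t : X) :
    skewD χ t x ∈ derivKer χ :=
  (mem_derivKer χ).2 fun l => (mem_derivKer χ).1 hx (t :: l)

/-- Maximality of `derivKer` among the subspaces of ker ε stable under all skew derivations. Each
closure property of `derivKer` below follows by exhibiting such a subspace. -/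
theorem le_derivKer {S : Submodule K (TV X K)} (h0 : ∀ x ∈ S, counitT X K x = 0)
    (h : ∀ x ∈ S, ∀ t, skewD χ t x ∈ S) : S ≤ derivKer χ := by
  intro x hx
  refine (mem_derivKer χ).2 fun l => ?_
  induction l generalizing x with
  | nil => exact h0 x hx
  | cons t l ih => exact ih (h x hx t)

theorem actT_mem_derivKer {x : TV X K} (hx : x ∈ derivKer χ) (r : X) :
    χ.actT r x ∈ derivKer χ := by
  have : (derivKer χ).map (χ.actT r).toLinearMap ≤ derivKer χ := by
    refine le_derivKer χ ?_ ?_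
    · rintro _ ⟨y, hy, rfl⟩
      exact (counitT_actT χ r y).trans (counitT_of_mem_derivKer χ hy)
    · rintro _ ⟨y, hy, rfl⟩ t
      obtain ⟨u, rfl⟩ : ∃ u, t = r ◃ u := ⟨r ◃⁻¹ t, by simp⟩
      rw [AlgHom.toLinearMap_apply, skewD_actT]
      exact Submodule.smul_mem _ _ ⟨_, skewD_mem_derivKer χ hy u, rfl⟩
  exact this ⟨x, hx, rfl⟩

theorem gen_mul_mem_derivKer {x : TV X K} (hx : x ∈ derivKer χ) (r : X) :
    gen K r * x ∈ derivKer χ := by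
  -- The first summand absorbs the term g_r(y) of the derivative of e_r y.
  have : derivKer χ ⊔ (derivKer χ).map (LinearMap.mulLeft K (gen K r)) ≤ derivKer χ := by
    refine le_derivKer χ ?_ ?_
    · intro z hz
      obtain ⟨y, hy, _, ⟨y', hy', rfl⟩, rfl⟩ := Submodule.mem_sup.1 hz
      simp [counitT_of_mem_derivKer χ hy]
    · intro z hz t
      obtain ⟨y, hy, _, ⟨y', hy', rfl⟩, rfl⟩ := Submodule.mem_sup.1 hz
      rw [map_add, LinearMap.mulLeft_apply, skewD_gen_mul]
      refine Submodule.add_mem _ (Submodule.mem_sup_left (skewD_mem_derivKer χ hy t)) ?_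
      exact Submodule.add_mem _
        (Submodule.mem_sup_right ⟨_, skewD_mem_derivKer χ hy' t, rfl⟩)
        (Submodule.mem_sup_left (Submodule.smul_mem _ _ (actT_mem_derivKer χ hy' r)))
  exact this (Submodule.mem_sup_right ⟨x, hx, rfl⟩)

theorem skewD_gen (t r : X) : skewD χ t (gen K r) = Finsupp.single r (1 : K) t • 1 := by
  simpa using skewD_gen_mul χ t r 1

theorem mul_gen_mem_derivKer {x : TV X K} (hx : x ∈ derivKer χ) (r : X) :
    x * gen K r ∈ derivKer χ := by
  -- All r are taken together, since the derivative of y e_r along t involves e_{t ◃ r}.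
  have : derivKer χ ⊔ Submodule.span K {z | ∃ y ∈ derivKer χ, ∃ r, z = y * gen K r} ≤
      derivKer χ := by
    refine le_derivKer χ ?_ ?_
    · intro z hz
      refine (sup_le (a := derivKer χ) (c := LinearMap.ker (counitT X K).toLinearMap)
        (fun y hy => counitT_of_mem_derivKer χ hy) (Submodule.span_le.2 ?_)) hz
      rintro _ ⟨y, hy, r, rfl⟩
      simp
    · intro z hz t
      rw [← Submodule.mem_comap]
      refine (sup_le (a := derivKer χ)
        (fun y hy => Submodule.mem_sup_left (skewD_mem_derivKer χ hy t))
        (Submodule.span_le.2 ?_)) hz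
      rintro _ ⟨y, hy, r, rfl⟩
      rw [SetLike.mem_coe, Submodule.mem_comap, skewD_mul, skewD_gen, actT_gen, mul_smul_comm,
        mul_smul_comm, mul_one]
      exact Submodule.add_mem _ (Submodule.mem_sup_left (Submodule.smul_mem _ _ hy))
        (Submodule.mem_sup_right (Submodule.smul_mem _ _
          (Submodule.subset_span ⟨_, skewD_mem_derivKer χ hy t, _, rfl⟩)))
  exact this (Submodule.mem_sup_right (Submodule.subset_span ⟨x, hx, r, rfl⟩))

theorem mul_mem_derivKer_left (v : TV X K) {x : TV X K} (hx : x ∈ derivKer χ) :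
    v * x ∈ derivKer χ := by
  induction v using TV_induction with
  | one => rwa [one_mul]
  | add v w hv hw => rw [add_mul]; exact Submodule.add_mem _ hv hw
  | smul k v hv => rw [smul_mul_assoc]; exact Submodule.smul_mem _ _ hv
  | mul r v hv => rw [mul_assoc]; exact gen_mul_mem_derivKer χ hv r

theorem mul_mem_derivKer_right (v : TV X K) {x : TV X K} (hx : x ∈ derivKer χ) :
    x * v ∈ derivKer χ := by
  induction v using TV_induction generalizing x with
  | one => rwa [mul_one]
  | add v w hv hw => rw [mul_add]; exact Submodule.add_mem _ (hv hx) (hw hx)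
  | smul k v hv => rw [mul_smul_comm]; exact Submodule.smul_mem _ _ (hv hx)
  | mul r v hv => rw [← mul_assoc]; exact hv (mul_gen_mem_derivKer χ hx r)

/-- The subspace `derivKer χ` as an ideal. -/
def derivIdeal : Ideal (TV X K) where
  __ := (derivKer χ).toAddSubmonoid
  smul_mem' v _ hx := mul_mem_derivKer_left χ v hx

theorem proj_mem_derivKer {x : TV X K} (hx : x ∈ derivKer χ) (i : ℕ) :
    GradedAlgebra.proj (homog X K) i x ∈ derivKer χ := by
  have : (⨆ i, (derivKer χ).map (GradedAlgebra.proj (homog X K) i)) ≤ derivKer χ := by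
    refine le_derivKer χ ?_ ?_
    · intro x hx
      refine (iSup_le (a := LinearMap.ker (counitT X K).toLinearMap) fun i => ?_) hx
      rintro _ ⟨y, hy, rfl⟩
      change counitT X K _ = 0
      have h : algebraMap K (TV X K) (counitT X K (GradedAlgebra.proj (homog X K) i y)) = 0 := by
        rw [← proj_zero]
        cases i with
        | zero => rw [proj_zero y, counitT_of_mem_derivKer χ hy, map_zero, map_zero]
        | succ i =>
          exact DirectSum.decompose_of_mem_ne (homog X K) (SetLike.coe_mem _) (by simp)
      exact (map_eq_zero _).1 h
    · intro x hx t
      rw [← Submodule.mem_comap]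
      refine (iSup_le fun i => ?_ : _ ≤ Submodule.comap (skewD χ t) _) hx
      rintro _ ⟨y, hy, rfl⟩
      rw [Submodule.mem_comap]
      cases i with
      | zero => rw [skewD_proj_zero]; exact Submodule.zero_mem _
      | succ i =>
        rw [skewD_proj_succ]
        exact Submodule.mem_iSup_of_mem i ⟨_, skewD_mem_derivKer χ hy t, rfl⟩
  exact this (Submodule.mem_iSup_of_mem i ⟨x, hx, rfl⟩)

theorem tensorSum_eq_ker (J : Submodule K (TV X K)) :
    tensorSum J = LinearMap.ker (TensorProduct.map J.mkQ J.mkQ) := by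
  rw [TensorProduct.map_ker (f := J.subtype) (f' := J.subtype) _ (Submodule.mkQ_surjective _) _
    (Submodule.mkQ_surjective _), tensorSum, sup_comm]
  all_goals exact LinearMap.exact_subtype_mkQ J

/-- A tensor is zero if it is annihilated by a separating family of functionals on the
second factor. -/
theorem eq_zero_of_lTensor_eq_zero {M N ι : Type*} [AddCommGroup M] [Module K M] [AddCommGroup N]
    [Module K N] (φ : ι → N →ₗ[K] K) (hφ : ∀ n, (∀ i, φ i n = 0) → n = 0) (z : M ⊗[K] N)
    (hz : ∀ i, (φ i).lTensor M z = 0) : z = 0 := by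
  classical
  let b := Module.Basis.ofVectorSpace K M
  apply (TensorProduct.equivFinsuppOfBasisLeft (N := N) b).injective
  rw [map_zero]
  ext j
  rw [Finsupp.zero_apply]
  refine hφ _ fun i => ?_
  have : φ i (TensorProduct.equivFinsuppOfBasisLeft (N := N) b z j) =
      TensorProduct.equivFinsuppOfBasisLeft (N := K) b ((φ i).lTensor M z) j := by
    generalize z = z
    induction z using TensorProduct.induction_on with
    | zero => simp
    | tmul x y => simp
    | add x y hx hy => simp only [map_add, Finsupp.add_apply, hx, hy]
  rw [this, hz, map_zero, Finsupp.zero_apply]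

theorem lTensor_iterD_comul (l : List X) (v : TV X K) :
    (iterD χ l).lTensor _ (χ.comul v) = χ.comul (iterD χ l v) := by
  induction l generalizing v with
  | nil => simp [iterD]
  | cons t l ih =>
    rw [iterD, LinearMap.lTensor_comp, LinearMap.comp_apply, lTensor_skewD_comul, ih]
    rfl

theorem iterD_mem_derivKer {x : TV X K} (hx : x ∈ derivKer χ) (l : List X) :
    iterD χ l x ∈ derivKer χ := by
  induction l generalizing x with
  | nil => exact hx
  | cons t l ih => exact ih (skewD_mem_derivKer χ hx t)

/-- The functionals ε ∘ `iterD` separate the points of TV/J for J = `derivKer χ`. Applied to the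
second factor of Δ(x), they return `iterD χ l x` by coassociativity and the counit law, and this
lies in J. -/
theorem comul_mem_of_mem_derivKer {x : TV X K} (hx : x ∈ derivKer χ) :
    χ.comul x ∈ tensorSum (derivKer χ) := by
  rw [tensorSum_eq_ker, LinearMap.mem_ker]
  let φ : List X → (TV X K ⧸ derivKer χ) →ₗ[K] K := fun l =>
    (derivKer χ).liftQ ((counitT X K).toLinearMap ∘ₗ iterD χ l)
      fun y hy => (mem_derivKer χ).1 hy l
  refine eq_zero_of_lTensor_eq_zero φ ?_ _ ?_
  · intro n hn
    obtain ⟨y, rfl⟩ := (derivKer χ).mkQ_surjective n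
    exact (Submodule.Quotient.mk_eq_zero _).2 ((mem_derivKer χ).2 fun l => hn l)
  · intro l
    have h1 : (φ l).lTensor _ (TensorProduct.map (derivKer χ).mkQ (derivKer χ).mkQ (χ.comul x)) =
        (derivKer χ).mkQ.rTensor _ ((counitT X K).toLinearMap.lTensor _
          (χ.comul (iterD χ l x))) := by
      rw [← lTensor_iterD_comul]
      generalize χ.comul x = z
      induction z using TensorProduct.induction_on with
      | zero => simp
      | tmul x y => simp only [TensorProduct.map_tmul, LinearMap.lTensor_tmul,
          LinearMap.rTensor_tmul]; rfl
      | add x y hx hy => simp only [map_add, hx, hy]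
    have h2 : (counitT X K).toLinearMap.lTensor _ (χ.comul (iterD χ l x)) =
        iterD χ l x ⊗ₜ[K] 1 := by
      apply (TensorProduct.rid K (TV X K)).injective
      rw [lTensor_counitT_comul, TensorProduct.rid_tmul, one_smul]
    rw [h1, h2, LinearMap.rTensor_tmul,
      (Submodule.mkQ_apply _ _).trans ((Submodule.Quotient.mk_eq_zero _).2
        (iterD_mem_derivKer χ hx l)), TensorProduct.zero_tmul]

theorem skewD_ι (t : X) (f : X →₀ K) : skewD χ t (TensorAlgebra.ι K f) = f t • 1 := by
  induction f using Finsupp.induction_linear with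
  | zero => simp
  | add f g hf hg => simp only [map_add, hf, hg, Finsupp.add_apply, add_smul]
  | single s k =>
    have h : TensorAlgebra.ι K (Finsupp.single s k) = k • gen K s := by
      rw [gen, ← map_smul, Finsupp.smul_single_one]
    rw [h, map_smul, skewD_gen, smul_smul, ← smul_eq_mul, ← Finsupp.smul_apply,
      Finsupp.smul_single_one]

theorem isNicholsIdeal_derivIdeal : IsNicholsIdeal χ (derivIdeal χ) where
  isTwoSided := ⟨fun b ha => mul_mem_derivKer_right χ b ha⟩
  isHomogeneous i _ hx := proj_mem_derivKer χ hx i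
  comul_mem _ hx := comul_mem_of_mem_derivKer χ hx
  two_le d x hx hxd hx0 := by
    by_contra hd
    refine hx0 ?_
    interval_cases d
    · rw [homog, pow_zero] at hxd
      obtain ⟨k, rfl⟩ := Submodule.mem_one.1 hxd
      have h := counitT_of_mem_derivKer χ hx
      rw [AlgHom.commutes, Algebra.algebraMap_self_apply] at h
      rw [h, map_zero]
    · rw [homog, pow_one] at hxd
      obtain ⟨f, rfl⟩ := hxd
      have hf : f = 0 := by
        ext t
        have h := counitT_of_mem_derivKer χ (skewD_mem_derivKer χ hx t)
        rwa [skewD_ι, map_smul, map_one, smul_eq_mul, mul_one] at h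
      rw [hf, map_zero]


/-- The functional taking the linear coefficient at e_t kills I, as I has nothing in degree one.
Hence id ⊗ e_t^* sends I ⊗ TV + TV ⊗ I into I. -/
theorem skewD_mem_nicholsIdeal {x : TV X K} (hx : x ∈ nicholsIdeal χ) (t : X) :
    skewD χ t x ∈ nicholsIdeal χ := by
  have h : tensorSum ((nicholsIdeal χ).restrictScalars K) ≤
      Submodule.comap ((TensorProduct.rid K (TV X K)).toLinearMap ∘ₗ
        (coeffT K t).lTensor (TV X K)) ((nicholsIdeal χ).restrictScalars K) := by
    refine sup_le ?_ ?_
    · rintro _ ⟨z, rfl⟩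
      induction z using TensorProduct.induction_on with
      | zero => rw [map_zero]; exact Submodule.zero_mem _
      | tmul y w => simpa using Submodule.smul_mem ((nicholsIdeal χ).restrictScalars K) _ y.2
      | add y w hy hw => rw [map_add]; exact Submodule.add_mem _ hy hw
    · rintro _ ⟨z, rfl⟩
      have h0 : coeffT K t ∘ₗ ((nicholsIdeal χ).restrictScalars K).subtype = 0 := by
        ext y
        have hy : GradedAlgebra.proj (homog X K) 1 (y : TV X K) = 0 :=
          proj_eq_zero_of_mem_nicholsIdeal χ one_lt_two y.2
        simp [coeffT, hy]
      rw [Submodule.mem_comap, LinearMap.comp_apply, ← LinearMap.comp_apply (LinearMap.lTensor _ _),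
        ← LinearMap.lTensor_comp, h0, LinearMap.lTensor_zero, LinearMap.zero_apply, map_zero]
      exact Submodule.zero_mem _
  exact h (comul_mem_of_mem_nicholsIdeal χ hx)

theorem mem_nicholsIdeal {x : TV X K} : x ∈ nicholsIdeal χ ↔ x ∈ derivKer χ := by
  constructor
  · intro hx
    refine le_derivKer (S := (nicholsIdeal χ).restrictScalars K) χ ?_
      (fun y hy t => skewD_mem_nicholsIdeal χ hy t) hx
    intro y hy
    have h : GradedAlgebra.proj (homog X K) 0 y = 0 :=
      proj_eq_zero_of_mem_nicholsIdeal χ zero_lt_two hy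
    rw [proj_zero] at h
    exact (map_eq_zero _).1 h
  · exact fun hx => le_nicholsIdeal (isNicholsIdeal_derivIdeal χ) hx

end

section

variable {X K : Type*} [Rack X] [Field K]

/-! ### Skew derivations of the Nichols algebra -/

variable (χ : Cocycle X K)

/-- Both sides are the coefficient of e_s in degree one. Together with `leftD_skewD` this makes left
derivations preserve `derivKer`. -/
theorem counitT_leftD (s : X) (v : TV X K) :
    counitT X K (leftD χ s v) = counitT X K (skewD χ s v) := by
  induction v using TV_induction with
  | one => simp
  | add v w hv hw => simp only [map_add, hv, hw]
  | smul k v hv => simp only [map_smul, hv]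
  | mul r v hv =>
    obtain ⟨u, rfl⟩ : ∃ u, s = r ◃ u := ⟨r ◃⁻¹ s, by simp⟩
    simp [leftD_gen_mul, skewD_gen_mul]

theorem leftD_mem_derivKer {x : TV X K} (hx : x ∈ derivKer χ) (s : X) :
    leftD χ s x ∈ derivKer χ := by
  have : (derivKer χ).map (leftD χ s) ≤ derivKer χ := by
    refine le_derivKer χ ?_ ?_
    · rintro _ ⟨y, hy, rfl⟩
      rw [counitT_leftD]
      exact counitT_of_mem_derivKer χ (skewD_mem_derivKer χ hy s)
    · rintro _ ⟨y, hy, rfl⟩ t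
      rw [← leftD_skewD]
      exact ⟨_, skewD_mem_derivKer χ hy t, rfl⟩
  exact this ⟨x, hx, rfl⟩

namespace NicholsAlgebra

theorem π_surjective : Function.Surjective (π χ) :=
  Ideal.Quotient.mkₐ_surjective K _

theorem π_eq_zero_iff {x : TV X K} : π χ x = 0 ↔ x ∈ derivKer χ := by
  rw [← mem_nicholsIdeal]
  exact Ideal.Quotient.eq_zero_iff_mem

@[elab_as_elim]
theorem induction {P : NicholsAlgebra χ → Prop} (one : P 1) (add : ∀ v w, P v → P w → P (v + w))
    (smul : ∀ (k : K) v, P v → P (k • v)) (mul : ∀ t v, P v → P (e χ t * v))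
    (v : NicholsAlgebra χ) : P v := by
  obtain ⟨x, rfl⟩ := π_surjective χ v
  induction x using TV_induction with
  | one => rwa [map_one]
  | add v w hv hw => rw [map_add]; exact add _ _ hv hw
  | smul k v hv => rw [map_smul]; exact smul _ _ hv
  | mul t v hv => rw [map_mul]; exact mul t _ hv

/-- The constant coefficient of an element of `𝔅`. -/
def counit : NicholsAlgebra χ →ₗ[K] K :=
  descend χ (counitT X K).toLinearMap fun _ hx =>
    counitT_of_mem_derivKer χ ((mem_nicholsIdeal χ).1 hx)

/-- The action of `g_r` on `𝔅`. -/
def act (r : X) : NicholsAlgebra χ →ₗ[K] NicholsAlgebra χ :=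
  descend χ ((π χ).toLinearMap ∘ₗ (χ.actT r).toLinearMap) fun _ hx =>
    (π_eq_zero_iff χ).2 (actT_mem_derivKer χ ((mem_nicholsIdeal χ).1 hx) r)

/-- The left braided derivation of `𝔅` belonging to `e_s`. -/
def leftPartial (s : X) : NicholsAlgebra χ →ₗ[K] NicholsAlgebra χ :=
  descend χ ((π χ).toLinearMap ∘ₗ leftD χ s) fun _ hx =>
    (π_eq_zero_iff χ).2 (leftD_mem_derivKer χ ((mem_nicholsIdeal χ).1 hx) s)

theorem counit_π (x : TV X K) : counit χ (π χ x) = counitT X K x := rfl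

theorem act_π (r : X) (x : TV X K) : act χ r (π χ x) = π χ (χ.actT r x) := rfl

theorem leftPartial_π (s : X) (x : TV X K) : leftPartial χ s (π χ x) = π χ (leftD χ s x) := rfl

theorem partialD_π (t : X) (x : TV X K) : partialD χ t (π χ x) = π χ (skewD χ t x) := by
  have h : comul χ (π χ x) =
    TensorProduct.map (π χ).toLinearMap (π χ).toLinearMap (χ.comul x) := rfl
  have hc : ∀ y, coeff χ t (π χ y) = coeffT K t y := fun y => rfl
  rw [partialD, LinearMap.comp_apply, LinearMap.comp_apply, h, skewD, LinearMap.comp_apply,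
    LinearMap.comp_apply]
  generalize χ.comul x = z
  induction z using TensorProduct.induction_on with
  | zero => simp
  | tmul x y => simp [hc]
  | add x y hx hy => simp only [map_add, hx, hy]

@[simp]
theorem counit_one : counit χ 1 = 1 := by
  rw [← map_one (π χ), counit_π, map_one]

@[simp]
theorem counit_e_mul (r : X) (v : NicholsAlgebra χ) : counit χ (e χ r * v) = 0 := by
  obtain ⟨x, rfl⟩ := π_surjective χ v
  rw [e, ← map_mul, counit_π, map_mul, counitT_gen, zero_mul]

@[simp]
theorem counit_act (r : X) (v : NicholsAlgebra χ) : counit χ (act χ r v) = counit χ v := by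
  obtain ⟨x, rfl⟩ := π_surjective χ v
  rw [act_π, counit_π, counit_π, counitT_actT]

@[simp]
theorem act_one (r : X) : act χ r 1 = 1 := by
  rw [← map_one (π χ), act_π, map_one]

theorem act_mul (r : X) (v w : NicholsAlgebra χ) : act χ r (v * w) = act χ r v * act χ r w := by
  obtain ⟨x, rfl⟩ := π_surjective χ v
  obtain ⟨y, rfl⟩ := π_surjective χ w
  rw [← map_mul, act_π, map_mul, map_mul]
  rfl

theorem act_e (r s : X) : act χ r (e χ s) = (χ.toFun r s : K) • e χ (r ◃ s) := by
  rw [e, act_π, actT_gen, map_smul, e]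

@[simp]
theorem partialD_one (t : X) : partialD χ t 1 = 0 := by
  rw [← map_one (π χ), partialD_π, skewD_one, map_zero]

@[simp]
theorem leftPartial_one (t : X) : leftPartial χ t 1 = 0 := by
  rw [← map_one (π χ), leftPartial_π, leftD_one, map_zero]

theorem partialD_mul (t : X) (v w : NicholsAlgebra χ) :
    partialD χ t (v * w) = v * partialD χ t w + partialD χ t v * act χ t w := by
  obtain ⟨x, rfl⟩ := π_surjective χ v
  obtain ⟨y, rfl⟩ := π_surjective χ w
  simp only [← map_mul, partialD_π, skewD_mul, act_π, map_add]

theorem partialD_e_mul (t r : X) (v : NicholsAlgebra χ) :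
    partialD χ t (e χ r * v) =
      e χ r * partialD χ t v + Finsupp.single r (1 : K) t • act χ r v := by
  obtain ⟨x, rfl⟩ := π_surjective χ v
  simp only [e, ← map_mul, partialD_π, skewD_gen_mul, act_π, map_add, map_smul]

theorem leftPartial_e_mul (r u : X) (v : NicholsAlgebra χ) :
    leftPartial χ (r ◃ u) (e χ r * v) = Finsupp.single r (1 : K) (r ◃ u) • v +
      (χ.toFun r u : K) • (e χ r * leftPartial χ u v) := by
  obtain ⟨x, rfl⟩ := π_surjective χ v
  simp only [e, ← map_mul, leftPartial_π, leftD_gen_mul, map_add, map_smul]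

theorem partialD_act (r t : X) (v : NicholsAlgebra χ) :
    partialD χ (r ◃ t) (act χ r v) = (χ.toFun r t : K) • act χ r (partialD χ t v) := by
  obtain ⟨x, rfl⟩ := π_surjective χ v
  rw [act_π, partialD_π, skewD_actT, map_smul, partialD_π, act_π]

theorem leftPartial_partialD (s t : X) (v : NicholsAlgebra χ) :
    leftPartial χ s (partialD χ t v) = partialD χ t (leftPartial χ s v) := by
  obtain ⟨x, rfl⟩ := π_surjective χ v
  rw [partialD_π, leftPartial_π, leftPartial_π, partialD_π, leftD_skewD]

/-- The composite `∂_{t_k} ⋯ ∂_{t_1}` on `𝔅` for a list `[t_1, …, t_k]`. -/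
def iterPartial : List X → NicholsAlgebra χ →ₗ[K] NicholsAlgebra χ
  | [] => LinearMap.id
  | t :: l => iterPartial l ∘ₗ partialD χ t

theorem iterPartial_π (l : List X) (x : TV X K) :
    iterPartial χ l (π χ x) = π χ (iterD χ l x) := by
  induction l generalizing x with
  | nil => rfl
  | cons t l ih => rw [iterPartial, LinearMap.comp_apply, partialD_π, ih]; rfl

/-- The iterated derivatives separate the elements of `𝔅`. -/
theorem eq_zero_of_counit_iterPartial {v : NicholsAlgebra χ}
    (h : ∀ l, counit χ (iterPartial χ l v) = 0) : v = 0 := by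
  obtain ⟨x, rfl⟩ := π_surjective χ v
  refine (π_eq_zero_iff χ).2 ((mem_derivKer χ).2 fun l => ?_)
  have := h l
  rwa [iterPartial_π, counit_π] at this

theorem eq_zero_of_partialD {v : NicholsAlgebra χ} (h0 : counit χ v = 0)
    (h : ∀ t, partialD χ t v = 0) : v = 0 := by
  refine eq_zero_of_counit_iterPartial χ fun l => ?_
  cases l with
  | nil => exact h0
  | cons t l => rw [iterPartial, LinearMap.comp_apply, h, map_zero, map_zero]

/-- An element of `𝔅` with vanishing derivatives is a constant. -/
theorem eq_counit_smul_one {v : NicholsAlgebra χ} (h : ∀ t, partialD χ t v = 0) :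
    v = counit χ v • 1 := by
  rw [← sub_eq_zero]
  refine eq_zero_of_partialD χ ?_ fun t => ?_
  · simp
  · rw [map_sub, map_smul, partialD_one, smul_zero, sub_zero, h]

/-! ### The grading by the inner group -/

theorem one_mem_component : (1 : NicholsAlgebra χ) ∈ component χ 1 :=
  Submodule.subset_span ⟨[], rfl, rfl⟩

theorem e_mul_mem_component {g : Inn X} (r : X) {v : NicholsAlgebra χ} (hv : v ∈ component χ g) :
    e χ r * v ∈ component χ (innGen r * g) := by
  have : component χ g ≤
      (component χ (innGen r * g)).comap (LinearMap.mulLeft K (e χ r)) := by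
    refine Submodule.span_le.2 ?_
    rintro _ ⟨l, rfl, rfl⟩
    exact Submodule.subset_span ⟨r :: l, by simp, by simp⟩
  exact this hv

@[elab_as_elim]
theorem component_induction {P : Inn X → NicholsAlgebra χ → Prop} (one : P 1 1)
    (zero : ∀ g, P g 0)
    (add : ∀ g v w, P g v → P g w → P g (v + w)) (smul : ∀ g (k : K) v, P g v → P g (k • v))
    (mul : ∀ g t v, v ∈ component χ g → P g v → P (innGen t * g) (e χ t * v))
    {g : Inn X} {v : NicholsAlgebra χ} (hv : v ∈ component χ g) : P g v := by
  refine Submodule.span_induction ?_ (zero g) (fun v w _ _ => add g v w)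
    (fun k v _ => smul g k v) hv
  rintro _ ⟨l, rfl, rfl⟩
  clear hv
  induction l with
  | nil => exact one
  | cons t l ih =>
    have hl : (l.map (e χ)).prod ∈ component χ (l.map innGen).prod :=
      Submodule.subset_span ⟨l, rfl, rfl⟩
    simpa using mul _ t _ hl ih

theorem act_mem_component {g : Inn X} (r : X) {v : NicholsAlgebra χ} (hv : v ∈ component χ g) :
    act χ r v ∈ component χ (innGen r * g * (innGen r)⁻¹) := by
  refine component_induction χ (P := fun g v =>
    act χ r v ∈ component χ (innGen r * g * (innGen r)⁻¹)) ?_ ?_ ?_ ?_ ?_ hv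
  · simpa using one_mem_component χ
  · simp
  · intro g v w hv hw
    rw [map_add]
    exact Submodule.add_mem _ hv hw
  · intro g k v hv
    rw [map_smul]
    exact Submodule.smul_mem _ _ hv
  · intro g t v _ hv
    rw [act_mul, act_e, smul_mul_assoc]
    refine Submodule.smul_mem _ _ ?_
    have := e_mul_mem_component χ (r ◃ t) hv
    rw [innGen_act] at this
    convert this using 2
    group

theorem single_smul_mem {M : Type*} [AddCommGroup M] [Module K M] (S : Submodule K M) {r s : X}
    {v : M} (h : r = s → v ∈ S) : Finsupp.single r (1 : K) s • v ∈ S := by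
  classical
  by_cases hrs : r = s
  · exact S.smul_mem _ (h hrs)
  · simp [hrs]

theorem partialD_mem_component {g : Inn X} (t : X) {v : NicholsAlgebra χ}
    (hv : v ∈ component χ g) : partialD χ t v ∈ component χ (g * (innGen t)⁻¹) := by
  refine component_induction χ (P := fun g v =>
    partialD χ t v ∈ component χ (g * (innGen t)⁻¹)) ?_ ?_ ?_ ?_ ?_ hv
  · simp
  · simp
  · intro g v w hv hw
    rw [map_add]
    exact Submodule.add_mem _ hv hw
  · intro g k v hv
    rw [map_smul]
    exact Submodule.smul_mem _ _ hv
  · intro g r v hvg hv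
    rw [partialD_e_mul, mul_assoc]
    refine Submodule.add_mem _ (e_mul_mem_component χ r hv) (single_smul_mem _ ?_)
    rintro rfl
    rw [← mul_assoc]
    exact act_mem_component χ r hvg

theorem leftPartial_mem_component {g : Inn X} (s : X) {v : NicholsAlgebra χ}
    (hv : v ∈ component χ g) : leftPartial χ s v ∈ component χ ((innGen s)⁻¹ * g) := by
  refine component_induction χ (P := fun g v =>
    ∀ s, leftPartial χ s v ∈ component χ ((innGen s)⁻¹ * g)) ?_ ?_ ?_ ?_ ?_ hv s
  · simp
  · simp
  · intro g v w hv hw s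
    rw [map_add]
    exact Submodule.add_mem _ (hv s) (hw s)
  · intro g k v hv s
    rw [map_smul]
    exact Submodule.smul_mem _ _ (hv s)
  · intro g r v hvg hv s
    obtain ⟨u, rfl⟩ : ∃ u, s = r ◃ u := ⟨r ◃⁻¹ s, by simp⟩
    rw [leftPartial_e_mul]
    refine Submodule.add_mem _ (single_smul_mem _ ?_) (Submodule.smul_mem _ _ ?_)
    · intro h
      rw [← h]
      simpa using hvg
    · have := e_mul_mem_component χ r (hv u)
      rw [innGen_act]
      convert this using 2
      group

theorem counit_of_mem_component {g : Inn X} (hg : g ≠ 1) {v : NicholsAlgebra χ}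
    (hv : v ∈ component χ g) : counit χ v = 0 := by
  refine component_induction χ (P := fun g v => g ≠ 1 → counit χ v = 0) ?_ ?_ ?_ ?_ ?_ hv hg
  · simp
  · simp
  · intro g v w hv hw hg
    rw [map_add, hv hg, hw hg, add_zero]
  · intro g k v hv hg
    rw [map_smul, hv hg, smul_zero]
  · simp

theorem counit_iterPartial_of_mem_component (l : List X) {g : Inn X}
    (hg : g ≠ (l.map innGen).reverse.prod) {v : NicholsAlgebra χ} (hv : v ∈ component χ g) :
    counit χ (iterPartial χ l v) = 0 := by
  induction l generalizing g v with
  | nil => exact counit_of_mem_component χ hg hv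
  | cons t l ih =>
    refine ih (fun h => hg ?_) (partialD_mem_component χ t hv)
    simp [← h]

theorem iSup_component : ⨆ g, component χ g = ⊤ := by
  refine eq_top_iff.2 fun v _ => ?_
  induction v using induction with
  | one => exact Submodule.mem_iSup_of_mem 1 (one_mem_component χ)
  | add v w hv hw => exact Submodule.add_mem _ (hv trivial) (hw trivial)
  | smul k v hv => exact Submodule.smul_mem _ k (hv trivial)
  | mul t v hv =>
    refine (iSup_le fun g => ?_ : _ ≤ (⨆ g, component χ g).comap (LinearMap.mulLeft K (e χ t)))
      (hv trivial)
    exact fun w hw => Submodule.mem_iSup_of_mem _ (e_mul_mem_component χ t hw)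

/-- Directness of the grading: each functional ε ∘ `iterPartial χ l` is non-zero on at most one
component, and these functionals separate the points of 𝔅. -/
theorem eq_zero_of_sum_component {s : Finset (Inn X)} {v : Inn X → NicholsAlgebra χ}
    (hv : ∀ g, v g ∈ component χ g) (h : ∑ g ∈ s, v g = 0) {g : Inn X} (hg : g ∈ s) : v g = 0 := by
  refine eq_zero_of_counit_iterPartial χ fun l => ?_
  by_cases hl : g = (l.map innGen).reverse.prod
  · have h1 := congrArg (fun w => counit χ (iterPartial χ l w)) h
    simp only [map_sum, map_zero] at h1
    rwa [Finset.sum_eq_single_of_mem g hg] at h1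
    intro g' _ hne
    exact counit_iterPartial_of_mem_component χ l (hl ▸ hne) (hv g')
  · exact counit_iterPartial_of_mem_component χ l hl (hv g)

end NicholsAlgebra

end

/-! ### Iterated derivations from a subrack -/

section

variable {X K : Type*} [Rack X] [Field K]

/-- Serves both for products of derivations (A = End 𝔅) and for products of generators (A = 𝔅), with
the number of factors tracked by `P`. -/
theorem span_image_pow_induction {A : Type*} [Ring A] [Algebra K A] {f : X → A} {Y : Set X}
    {P : ℕ → A → Prop} (one : P 0 1) (zero : ∀ i, P i 0)
    (add : ∀ i a b, P i a → P i b → P i (a + b)) (smul : ∀ i (k : K) a, P i a → P i (k • a))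
    (mul : ∀ i, ∀ t ∈ Y, ∀ a ∈ Submodule.span K (f '' Y) ^ i, P i a → P (i + 1) (f t * a))
    {i : ℕ} {a : A} (ha : a ∈ Submodule.span K (f '' Y) ^ i) : P i a := by
  induction i generalizing a with
  | zero =>
    rw [pow_zero] at ha
    obtain ⟨k, rfl⟩ := Submodule.mem_one.1 ha
    rw [Algebra.algebraMap_eq_smul_one]
    exact smul 0 k 1 one
  | succ i ih =>
    rw [pow_succ'] at ha
    refine Submodule.mul_induction_on ha (fun m hm n hn => ?_) (add (i + 1))
    refine Submodule.span_induction (p := fun m _ => P (i + 1) (m * n)) ?_ ?_ ?_ ?_ hm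
    · rintro _ ⟨t, ht, rfl⟩
      exact mul i t ht n hn (ih hn)
    · rw [zero_mul]; exact zero _
    · intro x y _ _ hx hy
      rw [add_mul]; exact add _ _ _ hx hy
    · intro k x _ hx
      rw [smul_mul_assoc]; exact smul _ _ _ hx

namespace NicholsAlgebra

variable (χ : Cocycle X K)

/-- The span of the braided derivations `∂_t`, `t ∈ Y`. -/
def derivSpan (Y : Set X) : Submodule K (Module.End K (NicholsAlgebra χ)) :=
  Submodule.span K (partialD χ '' Y)

/-- The span of the generators `e_t`, `t ∈ Y`. -/
def genSpan (Y : Set X) : Submodule K (NicholsAlgebra χ) :=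
  Submodule.span K (e χ '' Y)

/-- The elements of `𝔅` annihilated by all `∂_t`, `t ∈ Y`. -/
def invariants (Y : Set X) : Submodule K (NicholsAlgebra χ) :=
  ⨅ t ∈ Y, LinearMap.ker (partialD χ t)

variable {χ} {Y : Set X}

theorem mem_invariants {v : NicholsAlgebra χ} :
    v ∈ invariants χ Y ↔ ∀ t ∈ Y, partialD χ t v = 0 := by
  simp [invariants]

theorem partialD_mem_derivSpan {t : X} (ht : t ∈ Y) : partialD χ t ∈ derivSpan χ Y :=
  Submodule.subset_span ⟨t, ht, rfl⟩

theorem partialD_mul_mem_pow {t : X} (ht : t ∈ Y) {i : ℕ} {T : Module.End K (NicholsAlgebra χ)}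
    (hT : T ∈ derivSpan χ Y ^ i) : partialD χ t * T ∈ derivSpan χ Y ^ (i + 1) := by
  rw [pow_succ']
  exact Submodule.mul_mem_mul (partialD_mem_derivSpan ht) hT

theorem mul_partialD_mem_pow {t : X} (ht : t ∈ Y) {i : ℕ} {T : Module.End K (NicholsAlgebra χ)}
    (hT : T ∈ derivSpan χ Y ^ i) : T * partialD χ t ∈ derivSpan χ Y ^ (i + 1) := by
  rw [pow_succ]
  exact Submodule.mul_mem_mul hT (partialD_mem_derivSpan ht)

/-- Commutation of iterated derivations from `Y` with the multiplication by `e_s`, `s ∈ Y`. -/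
theorem exists_apply_e_mul (hY : IsSubrack Y) {s : X} (hs : s ∈ Y) {i : ℕ}
    {T : Module.End K (NicholsAlgebra χ)} (hT : T ∈ derivSpan χ Y ^ i) :
    ∃ T' : Module.End K (NicholsAlgebra χ), (∀ j, i = j + 1 → T' ∈ derivSpan χ Y ^ j) ∧
      (i = 0 → T' = 0) ∧ ∀ v, T (e χ s * v) = e χ s * T v + act χ s (T' v) := by
  refine span_image_pow_induction
    (P := fun i T => ∃ T' : Module.End K (NicholsAlgebra χ),
      (∀ j, i = j + 1 → T' ∈ derivSpan χ Y ^ j) ∧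
      (i = 0 → T' = 0) ∧ ∀ v, T (e χ s * v) = e χ s * T v + act χ s (T' v)) ?_ ?_ ?_ ?_ ?_ hT
  · exact ⟨0, by simp, by simp, by simp⟩
  · exact fun i => ⟨0, fun j _ => Submodule.zero_mem _, by simp, by simp⟩
  · rintro i T U ⟨T', h1, h2, h3⟩ ⟨U', k1, k2, k3⟩
    refine ⟨T' + U', fun j hj => Submodule.add_mem _ (h1 j hj) (k1 j hj),
      fun h => by rw [h2 h, k2 h, add_zero], fun v => ?_⟩
    simp only [LinearMap.add_apply, h3, k3, mul_add, map_add]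
    abel
  · rintro i k T ⟨T', h1, h2, h3⟩
    refine ⟨k • T', fun j hj => Submodule.smul_mem _ _ (h1 j hj),
      fun h => by rw [h2 h, smul_zero], fun v => ?_⟩
    simp only [LinearMap.smul_apply, h3, mul_smul_comm, map_smul, smul_add]
  · rintro i t ht T hT ⟨T', h1, h2, h3⟩
    obtain ⟨u, rfl⟩ : ∃ u, t = s ◃ u := ⟨s ◃⁻¹ t, by simp⟩
    have hu : u ∈ Y := by simpa using (hY s hs _ ht).2
    -- Read off from applying `∂_{s ◃ u}` to e_s T(v) + g_s(T' v). Closure of Y under ◃⁻¹ gives u ∈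
    -- Y. The operator T' has degree i - 1, and the clause T' = 0 for i = 0 stands in for a negative
    -- degree.
    refine ⟨Finsupp.single s (1 : K) (s ◃ u) • T + (χ.toFun s u : K) • (partialD χ u * T'),
      ?_, by simp, ?_⟩
    · intro j hj
      obtain rfl : i = j := by omega
      refine Submodule.add_mem _ (Submodule.smul_mem _ _ hT) (Submodule.smul_mem _ _ ?_)
      cases i with
      | zero => rw [h2 rfl, mul_zero]; exact Submodule.zero_mem _
      | succ j => exact partialD_mul_mem_pow hu (h1 j rfl)
    · intro v
      simp only [Module.End.mul_apply, h3, map_add, partialD_e_mul, partialD_act,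
        LinearMap.add_apply, LinearMap.smul_apply, map_smul]
      abel

theorem apply_e_mul_of_notMem {s : X} (hs : s ∉ Y) {i : ℕ}
    {T : Module.End K (NicholsAlgebra χ)} (hT : T ∈ derivSpan χ Y ^ i) (v : NicholsAlgebra χ) :
    T (e χ s * v) = e χ s * T v := by
  refine span_image_pow_induction
    (P := fun _ T => T (e χ s * v) = e χ s * T v) ?_ ?_ ?_ ?_ ?_ hT
  · rfl
  · intro i; simp
  · intro i T U hT hU
    rw [LinearMap.add_apply, LinearMap.add_apply, hT, hU, mul_add]
  · intro i k T hT
    rw [LinearMap.smul_apply, LinearMap.smul_apply, hT, mul_smul_comm]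
  · intro i t ht T _ hT
    have hst : s ≠ t := fun h => hs (h ▸ ht)
    rw [Module.End.mul_apply, hT, partialD_e_mul, Finsupp.single_eq_of_ne hst.symm, zero_smul,
      add_zero]
    rfl

theorem apply_eq_zero_of_pow {i : ℕ} {v : NicholsAlgebra χ}
    (hv : ∀ T ∈ derivSpan χ Y ^ i, T v = 0) : ∀ T ∈ derivSpan χ Y ^ (i + 1), T v = 0 := by
  intro T hT
  rw [pow_succ'] at hT
  refine Submodule.mul_induction_on hT (fun U _ V hV => ?_) (fun U V hU hV => ?_)
  · rw [Module.End.mul_apply, hv V hV, map_zero]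
  · rw [LinearMap.add_apply, hU, hV, add_zero]

theorem apply_eq_zero_of_le {i j : ℕ} (hij : i ≤ j) {v : NicholsAlgebra χ}
    (hv : ∀ T ∈ derivSpan χ Y ^ i, T v = 0) : ∀ T ∈ derivSpan χ Y ^ j, T v = 0 := by
  induction j, hij using Nat.le_induction with
  | base => exact hv
  | succ j _ ih => exact apply_eq_zero_of_pow ih

theorem apply_one {i : ℕ} {T : Module.End K (NicholsAlgebra χ)}
    (hT : T ∈ derivSpan χ Y ^ (i + 1)) : T 1 = 0 := by
  rw [pow_succ] at hT
  refine Submodule.mul_induction_on hT (fun U _ V hV => ?_) (fun U V hU hV => ?_)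
  · have : derivSpan χ Y ≤ LinearMap.ker (LinearMap.applyₗ (1 : NicholsAlgebra χ)) := by
      refine Submodule.span_le.2 ?_
      rintro _ ⟨t, _, rfl⟩
      exact partialD_one χ t
    have hV1 : V 1 = 0 := this hV
    rw [Module.End.mul_apply, hV1, map_zero]
  · rw [LinearMap.add_apply, hU, hV, add_zero]

theorem apply_e_mul_eq_zero (hY : IsSubrack Y) (s : X) {i : ℕ} {v : NicholsAlgebra χ}
    (hv : ∀ T ∈ derivSpan χ Y ^ i, T v = 0) :
    ∀ T ∈ derivSpan χ Y ^ (i + 1), T (e χ s * v) = 0 := by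
  intro T hT
  by_cases hs : s ∈ Y
  · obtain ⟨T', h1, -, h3⟩ := exists_apply_e_mul hY hs hT
    rw [h3, apply_eq_zero_of_pow hv T hT, hv T' (h1 i rfl), map_zero, mul_zero, add_zero]
  · rw [apply_e_mul_of_notMem hs hT, apply_eq_zero_of_pow hv T hT, mul_zero]

/-- The derivations from `Y` act locally nilpotently on `𝔅`. -/
theorem exists_pow_apply_eq_zero (hY : IsSubrack Y) (v : NicholsAlgebra χ) :
    ∃ i, ∀ T ∈ derivSpan χ Y ^ i, T v = 0 := by
  induction v using induction with
  | one => exact ⟨1, fun T hT => apply_one (i := 0) hT⟩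
  | add v w hv hw =>
    obtain ⟨i, hi⟩ := hv
    obtain ⟨j, hj⟩ := hw
    refine ⟨max i j, fun T hT => ?_⟩
    rw [map_add, apply_eq_zero_of_le (le_max_left i j) hi T hT,
      apply_eq_zero_of_le (le_max_right i j) hj T hT, add_zero]
  | smul k v hv =>
    obtain ⟨i, hi⟩ := hv
    exact ⟨i, fun T hT => by rw [map_smul, hi T hT, smul_zero]⟩
  | mul t v hv =>
    obtain ⟨i, hi⟩ := hv
    exact ⟨i + 1, apply_e_mul_eq_zero hY t hi⟩

/-- An iterated derivation from `Y` which annihilates the monomials in `Y` of the same degree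
vanishes. -/
theorem eq_zero_of_counit_apply (hY : IsSubrack Y) {i : ℕ}
    {T : Module.End K (NicholsAlgebra χ)} (hT : T ∈ derivSpan χ Y ^ i)
    (h : ∀ w ∈ genSpan χ Y ^ i, counit χ (T w) = 0) : T = 0 := by
  induction i generalizing T with
  | zero =>
    rw [pow_zero] at hT
    obtain ⟨k, rfl⟩ := Submodule.mem_one.1 hT
    have := h 1 (by rw [pow_zero]; exact Submodule.one_le.1 le_rfl)
    rw [Module.algebraMap_end_apply, map_smul, counit_one, smul_eq_mul, mul_one] at this
    rw [this, map_zero]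
  | succ i ih =>
    -- Once T commutes with all left multiplications, it is determined by T 1, which is 0 in
    -- positive degree.
    have hc : ∀ s v, T (e χ s * v) = e χ s * T v := by
      intro s v
      by_cases hs : s ∈ Y
      · obtain ⟨T', h1, -, h3⟩ := exists_apply_e_mul hY hs hT
        have hT' : T' = 0 := by
          refine ih (h1 i rfl) fun w hw => ?_
          have hsw : e χ s * w ∈ genSpan χ Y ^ (i + 1) := by
            rw [pow_succ']
            exact Submodule.mul_mem_mul (Submodule.subset_span ⟨s, hs, rfl⟩) hw
          have := h _ hsw
          rwa [h3, map_add, counit_e_mul, zero_add, counit_act] at this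
        rw [h3, hT', LinearMap.zero_apply, map_zero, add_zero]
      · exact apply_e_mul_of_notMem hs hT v
    ext v
    rw [LinearMap.zero_apply]
    induction v using induction with
    | one => exact apply_one hT
    | add v w hv hw => rw [map_add, hv, hw, add_zero]
    | smul k v hv => rw [map_smul, hv, smul_zero]
    | mul t v hv => rw [hc, hv, mul_zero]

theorem counit_apply_of_lt (hY : IsSubrack Y) {i j : ℕ} (hij : i < j)
    {T : Module.End K (NicholsAlgebra χ)} (hT : T ∈ derivSpan χ Y ^ i) {w : NicholsAlgebra χ}
    (hw : w ∈ genSpan χ Y ^ j) : counit χ (T w) = 0 := by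
  refine span_image_pow_induction (P := fun j w => ∀ i < j, ∀ T ∈ derivSpan χ Y ^ i,
    counit χ (T w) = 0) ?_ ?_ ?_ ?_ ?_ hw i hij T hT
  · simp
  · simp
  · intro j v w hv hw i hij T hT
    rw [map_add, map_add, hv i hij T hT, hw i hij T hT, add_zero]
  · intro j k v hv i hij T hT
    rw [map_smul, map_smul, hv i hij T hT, smul_zero]
  · intro j s hs w _ hw i hij T hT
    obtain ⟨T', h1, h2, h3⟩ := exists_apply_e_mul hY hs hT
    rw [h3, map_add, counit_e_mul, zero_add, counit_act]
    cases i with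
    | zero => rw [h2 rfl, LinearMap.zero_apply, map_zero]
    | succ i => exact hw i (by omega) T' (h1 i rfl)

theorem apply_eq_zero_of_mem_genSpan_pow (hY : IsSubrack Y) {i : ℕ} {w : NicholsAlgebra χ}
    (hw : w ∈ genSpan χ Y ^ i) : ∀ T ∈ derivSpan χ Y ^ (i + 1), T w = 0 := by
  refine span_image_pow_induction (P := fun i w => ∀ T ∈ derivSpan χ Y ^ (i + 1), T w = 0)
    ?_ ?_ ?_ ?_ ?_ hw
  · exact fun T hT => apply_one hT
  · simp
  · intro i v w hv hw T hT
    rw [map_add, hv T hT, hw T hT, add_zero]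
  · intro i k v hv T hT
    rw [map_smul, hv T hT, smul_zero]
  · intro i s _ w _ hw
    exact apply_e_mul_eq_zero hY s hw

/-! ### The subalgebra generated by a subrack -/

theorem e_mem_sub {t : X} (ht : t ∈ Y) : e χ t ∈ sub χ Y :=
  Algebra.subset_adjoin ⟨t, ht, rfl⟩

theorem genSpan_pow_le_sub (i : ℕ) : genSpan χ Y ^ i ≤ Subalgebra.toSubmodule (sub χ Y) := by
  intro w hw
  refine span_image_pow_induction (P := fun _ w => w ∈ sub χ Y) ?_ ?_ ?_ ?_ ?_ hw
  · exact one_mem _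
  · exact fun i => zero_mem _
  · exact fun i a b ha hb => add_mem ha hb
  · exact fun i k a ha => Subalgebra.smul_mem _ ha k
  · exact fun i t ht a _ ha => mul_mem (e_mem_sub ht) ha

theorem act_mem_sub (hY : IsSubrack Y) {t : X} (ht : t ∈ Y) {v : NicholsAlgebra χ}
    (hv : v ∈ sub χ Y) : act χ t v ∈ sub χ Y := by
  refine Algebra.adjoin_induction (p := fun v _ => act χ t v ∈ sub χ Y) ?_ ?_ ?_ ?_ hv
  · rintro _ ⟨s, hs, rfl⟩
    rw [act_e]
    exact Subalgebra.smul_mem _ (e_mem_sub (hY t ht s hs).1) _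
  · intro k
    rw [Algebra.algebraMap_eq_smul_one, map_smul, act_one]
    exact Subalgebra.smul_mem _ (one_mem _) k
  · intro v w _ _ hv hw
    rw [map_add]
    exact add_mem hv hw
  · intro v w _ _ hv hw
    rw [act_mul]
    exact mul_mem hv hw

theorem partialD_e (t r : X) : partialD χ t (e χ r) = Finsupp.single r (1 : K) t • 1 := by
  simpa using partialD_e_mul χ t r 1

theorem partialD_mem_sub (hY : IsSubrack Y) {t : X} (ht : t ∈ Y) {v : NicholsAlgebra χ}
    (hv : v ∈ sub χ Y) : partialD χ t v ∈ sub χ Y := by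
  refine Algebra.adjoin_induction (p := fun v _ => partialD χ t v ∈ sub χ Y) ?_ ?_ ?_ ?_ hv
  · rintro _ ⟨s, hs, rfl⟩
    rw [partialD_e]
    exact Subalgebra.smul_mem _ (one_mem _) _
  · intro k
    rw [Algebra.algebraMap_eq_smul_one, map_smul, partialD_one, smul_zero]
    exact zero_mem _
  · intro v w _ _ hv hw
    rw [map_add]
    exact add_mem hv hw
  · intro v w hvs hws hv hw
    rw [partialD_mul]
    exact add_mem (mul_mem hvs hw) (mul_mem hv (act_mem_sub hY ht hws))

theorem partialD_of_notMem {t : X} (ht : t ∉ Y) {v : NicholsAlgebra χ}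
    (hv : v ∈ sub χ Y) : partialD χ t v = 0 := by
  refine Algebra.adjoin_induction (p := fun v _ => partialD χ t v = 0) ?_ ?_ ?_ ?_ hv
  · rintro _ ⟨s, hs, rfl⟩
    have hst : t ≠ s := fun h => ht (h ▸ hs)
    rw [partialD_e, Finsupp.single_eq_of_ne hst, zero_smul]
  · intro k
    rw [Algebra.algebraMap_eq_smul_one, map_smul, partialD_one, smul_zero]
  · intro v w _ _ hv hw
    rw [map_add, hv, hw, add_zero]
  · intro v w _ _ hv hw
    rw [partialD_mul, hv, hw, mul_zero, zero_mul, add_zero]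

theorem apply_mem_sub (hY : IsSubrack Y) {i : ℕ} {T : Module.End K (NicholsAlgebra χ)}
    (hT : T ∈ derivSpan χ Y ^ i) {v : NicholsAlgebra χ} (hv : v ∈ sub χ Y) : T v ∈ sub χ Y := by
  refine span_image_pow_induction (P := fun _ T => T v ∈ sub χ Y) ?_ ?_ ?_ ?_ ?_ hT
  · exact hv
  · exact fun i => zero_mem _
  · exact fun i a b ha hb => add_mem ha hb
  · exact fun i k a ha => Subalgebra.smul_mem _ ha k
  · exact fun i t ht a _ ha => partialD_mem_sub hY ht ha

/-- An element of the subalgebra generated by `Y` with vanishing derivatives from `Y` is a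
constant. -/
theorem eq_counit_smul_one_of_mem_sub {v : NicholsAlgebra χ} (hv : v ∈ sub χ Y)
    (h : ∀ t ∈ Y, partialD χ t v = 0) : v = counit χ v • 1 := by
  refine eq_counit_smul_one χ fun t => ?_
  by_cases ht : t ∈ Y
  · exact h t ht
  · exact partialD_of_notMem ht hv

theorem apply_eq_counit_smul_one (hY : IsSubrack Y) {i : ℕ}
    {T : Module.End K (NicholsAlgebra χ)} (hT : T ∈ derivSpan χ Y ^ i) {w : NicholsAlgebra χ}
    (hw : w ∈ genSpan χ Y ^ i) : T w = counit χ (T w) • 1 :=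
  eq_counit_smul_one_of_mem_sub (apply_mem_sub hY hT (genSpan_pow_le_sub i hw)) fun _ ht =>
    apply_eq_zero_of_mem_genSpan_pow hY hw _ (partialD_mul_mem_pow ht hT)

theorem eq_zero_of_counit_apply' (hY : IsSubrack Y) {j : ℕ} {w : NicholsAlgebra χ}
    (hw : w ∈ genSpan χ Y ^ j) (h : ∀ T ∈ derivSpan χ Y ^ j, counit χ (T w) = 0) : w = 0 := by
  -- Descent on i: if degree i + 1 kills w, then T w is a constant for T of degree i. This constant
  -- is 0 by counting degrees when i < j and by hypothesis when i = j.
  have key : ∀ i ≤ j + 1, (∀ T ∈ derivSpan χ Y ^ i, T w = 0) → w = 0 := by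
    intro i hi hT
    induction i with
    | zero => exact hT 1 (by rw [pow_zero]; exact Submodule.one_le.1 le_rfl)
    | succ i ih =>
      refine ih (by omega) fun T hT' => ?_
      rw [eq_counit_smul_one_of_mem_sub (apply_mem_sub hY hT' (genSpan_pow_le_sub j hw))
        fun t ht => hT _ (partialD_mul_mem_pow ht hT')]
      have h0 : counit χ (T w) = 0 := by
        rcases Nat.lt_or_eq_of_le (Nat.le_of_succ_le_succ hi) with hij | rfl
        · exact counit_apply_of_lt hY hij hT' hw
        · exact h T hT'
      rw [h0, zero_smul]
  exact key (j + 1) le_rfl (apply_eq_zero_of_mem_genSpan_pow hY hw)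

/-! ### Freeness over the subalgebra generated by a subrack -/

/-- The pairing of iterated derivations and monomials of the same degree. -/
def derivPairing (χ : Cocycle X K) (Y : Set X) (i : ℕ) :
    ↥(derivSpan χ Y ^ i) →ₗ[K] ↥(genSpan χ Y ^ i) →ₗ[K] K :=
  ((LinearMap.compRight K (counit χ)) ∘ₗ
    (LinearMap.lcomp K (NicholsAlgebra χ) (genSpan χ Y ^ i).subtype)) ∘ₗ
    (derivSpan χ Y ^ i).subtype

theorem derivPairing_apply (i : ℕ) (T : ↥(derivSpan χ Y ^ i)) (w : ↥(genSpan χ Y ^ i)) :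
    derivPairing χ Y i T w = counit χ (T.1 w.1) := rfl

theorem isPerfPair_derivPairing [FiniteDimensional K (NicholsAlgebra χ)] (hY : IsSubrack Y)
    (i : ℕ) : LinearMap.IsPerfPair (R := K) (M := ↥(derivSpan χ Y ^ i)) (N := ↥(genSpan χ Y ^ i))
      (derivPairing χ Y i) := by
  refine LinearMap.IsPerfPair.of_injective' ?_ ?_
  · refine (injective_iff_map_eq_zero _).2 fun T hT => Subtype.ext ?_
    exact eq_zero_of_counit_apply hY T.2 fun w hw => LinearMap.congr_fun hT ⟨w, hw⟩
  · refine (injective_iff_map_eq_zero _).2 fun w hw => Subtype.ext ?_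
    exact eq_zero_of_counit_apply' hY w.2 fun T hT => LinearMap.congr_fun hw ⟨T, hT⟩

theorem apply_invariants_mul {i : ℕ} {T : Module.End K (NicholsAlgebra χ)}
    (hT : T ∈ derivSpan χ Y ^ i) {a : NicholsAlgebra χ} (ha : a ∈ invariants χ Y)
    (w : NicholsAlgebra χ) : T (a * w) = a * T w := by
  refine span_image_pow_induction (P := fun _ T => T (a * w) = a * T w) ?_ ?_ ?_ ?_ ?_ hT
  · rfl
  · simp
  · intro i T U hT hU
    rw [LinearMap.add_apply, LinearMap.add_apply, hT, hU, mul_add]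
  · intro i k T hT
    rw [LinearMap.smul_apply, LinearMap.smul_apply, hT, mul_smul_comm]
  · intro i t ht T _ hT
    rw [Module.End.mul_apply, hT, partialD_mul, mem_invariants.1 ha t ht, zero_mul, add_zero]
    rfl

/-- Induction on the number i of derivations from Y that suffice to kill v; a correction by dual
bases in the top degree lowers i. -/
theorem invariants_mul_sub [FiniteDimensional K (NicholsAlgebra χ)] (hY : IsSubrack Y) :
    invariants χ Y * Subalgebra.toSubmodule (sub χ Y) = ⊤ := by
  refine eq_top_iff.2 fun v _ => ?_
  obtain ⟨i, hi⟩ := exists_pow_apply_eq_zero hY v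
  induction i generalizing v with
  | zero =>
    have : v = 0 := hi 1 (by rw [pow_zero]; exact Submodule.one_le.1 le_rfl)
    rw [this]
    exact Submodule.zero_mem _
  | succ i ih =>
    have hp := isPerfPair_derivPairing (χ := χ) hY i
    let b := Module.finBasis K ↥(genSpan χ Y ^ i)
    -- The basis of operators dual to `b` under the pairing.
    choose T hT' using fun j => hp.bijective_left.2 (b.coord j)
    have hT : ∀ j w, counit χ ((T j).1 w.1) = b.coord j w := fun j w => by
      rw [← derivPairing_apply, hT']
    have hsum : ∀ U : ↥(derivSpan χ Y ^ i), U = ∑ j, counit χ (U.1 (b j).1) • T j := by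
      intro U
      refine hp.bijective_left.1 (b.ext fun k => ?_)
      simp only [map_sum, map_smul, LinearMap.sum_apply, LinearMap.smul_apply,
        derivPairing_apply, hT, Module.Basis.coord_apply, Module.Basis.repr_self, smul_eq_mul]
      rw [Finset.sum_eq_single k]
      · simp
      · intro j _ hj
        rw [Finsupp.single_eq_of_ne hj, mul_zero]
      · simp
    have hinv : ∀ j, (T j).1 v ∈ invariants χ Y := fun j =>
      mem_invariants.2 fun t ht => hi _ (partialD_mul_mem_pow ht (T j).2)
    -- An operator U of degree i is linear over the invariants T_j(v) and sends b_j to the constant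
    -- ε(U b_j). By the expansion of U in the T_j it therefore kills this difference.
    have h1 : v - ∑ j, (T j).1 v * (b j).1 ∈
        invariants χ Y * Subalgebra.toSubmodule (sub χ Y) := by
      refine ih _ trivial fun U hU => ?_
      have hU' : U v = ∑ j, counit χ (U (b j).1) • (T j).1 v := by
        have h := congrArg (fun V : ↥(derivSpan χ Y ^ i) => V.1 v) (hsum ⟨U, hU⟩)
        simpa using h
      rw [map_sub, map_sum, hU', sub_eq_zero]
      refine Finset.sum_congr rfl fun j _ => ?_
      rw [apply_invariants_mul hU (hinv j), apply_eq_counit_smul_one hY hU (b j).2,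
        mul_smul_comm, mul_one, map_smul, counit_one, smul_eq_mul, mul_one]
    have h2 : ∑ j, (T j).1 v * (b j).1 ∈
        invariants χ Y * Subalgebra.toSubmodule (sub χ Y) := by
      exact Submodule.sum_mem _ fun j _ =>
        Submodule.mul_mem_mul (hinv j) (genSpan_pow_le_sub i (b j).2)
    rw [← sub_add_cancel v (∑ j, (T j).1 v * (b j).1)]
    exact Submodule.add_mem _ h1 h2

/-- Derivations from Y pass through the invariants b_j, so a derived relation has coefficients of
lower nilpotency and is trivial by induction. The w_j are then constants, and the linear
independence of `b` finishes. -/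
theorem eq_zero_of_sum_invariants_mul {ι : Type*} [Fintype ι] (hY : IsSubrack Y)
    (b : Module.Basis ι K ↥(invariants χ Y)) (i : ℕ) (w : ι → NicholsAlgebra χ)
    (hw : ∀ j, w j ∈ sub χ Y) (hi : ∀ j, ∀ T ∈ derivSpan χ Y ^ i, T (w j) = 0)
    (h : ∑ j, (b j).1 * w j = 0) (j : ι) : w j = 0 := by
  induction i generalizing w j with
  | zero => exact hi j 1 (by rw [pow_zero]; exact Submodule.one_le.1 le_rfl)
  | succ i ih =>
    have hD : ∀ j, ∀ t ∈ Y, partialD χ t (w j) = 0 := by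
      intro j t ht
      refine ih (fun j => partialD χ t (w j)) (fun j => partialD_mem_sub hY ht (hw j))
        (fun j T hT => hi j _ (mul_partialD_mem_pow ht hT)) ?_ j
      have := congrArg (partialD χ t) h
      rw [map_sum, map_zero] at this
      rw [← this]
      refine Finset.sum_congr rfl fun j _ => ?_
      rw [partialD_mul, mem_invariants.1 (b j).2 t ht, zero_mul, add_zero]
    have hc : ∀ j, w j = counit χ (w j) • 1 := fun j =>
      eq_counit_smul_one_of_mem_sub (hw j) (hD j)
    have hsum : ∑ j, counit χ (w j) • b j = 0 := by
      refine Subtype.ext ?_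
      rw [Submodule.coe_sum, Submodule.coe_zero, ← h]
      refine Finset.sum_congr rfl fun j _ => ?_
      rw [hc j, mul_smul_comm, mul_one, map_smul, counit_one, smul_eq_mul, mul_one]
      rfl
    rw [hc j, Fintype.linearIndependent_iff.1 b.linearIndependent _ hsum j, zero_smul]

theorem linearDisjoint_invariants_sub [FiniteDimensional K (NicholsAlgebra χ)]
    (hY : IsSubrack Y) :
    (invariants χ Y).LinearDisjoint (Subalgebra.toSubmodule (sub χ Y)) := by
  let b := Module.finBasis K ↥(invariants χ Y)
  refine Submodule.LinearDisjoint.of_basis_left _ _ b (LinearMap.ker_eq_bot'.2 fun n hn => ?_)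
  rw [Submodule.mulLeftMap_apply, Finsupp.sum_fintype _ _ (by simp)] at hn
  choose i hi using fun j => exists_pow_apply_eq_zero hY (n j).1
  ext j
  exact eq_zero_of_sum_invariants_mul hY b (Finset.univ.sup i) (fun j => (n j).1)
    (fun j => (n j).2)
    (fun j => apply_eq_zero_of_le (Finset.le_sup (Finset.mem_univ j)) (hi j)) hn j

/-- `𝔅` is free over the subalgebra generated by `Y`, with the invariants as a space of
generators. -/
theorem finrank_eq_finrank_invariants_mul [FiniteDimensional K (NicholsAlgebra χ)]
    (hY : IsSubrack Y) :
    Module.finrank K (NicholsAlgebra χ) =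
      Module.finrank K ↥(invariants χ Y) * Module.finrank K ↥(sub χ Y) := by
  have h1 := LinearMap.finrank_range_of_inj (linearDisjoint_invariants_sub (χ := χ) hY).injective
  rw [Submodule.mulMap_range, invariants_mul_sub hY, finrank_top, Module.finrank_tensorProduct]
    at h1
  exact h1

end NicholsAlgebra

end

section

variable {X K : Type*} [Rack X] [Field K]

namespace NicholsAlgebra

variable {χ : Cocycle X K} {Y : Set X}

/-! ### The grading of the invariants -/

theorem mem_invariants_of_sum_component [Fintype (Inn X)] {v : Inn X → NicholsAlgebra χ}
    (hv : ∀ g, v g ∈ component χ g) (h : ∑ g, v g ∈ invariants χ Y) (g : Inn X) :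
    v g ∈ invariants χ Y := by
  refine mem_invariants.2 fun t ht => ?_
  have h0 := mem_invariants.1 h t ht
  -- `∂_t` shifts degrees by right multiplication with g_t⁻¹; after reindexing, the summand at g has
  -- degree g.
  rw [map_sum, ← Equiv.sum_comp (Equiv.mulRight (innGen t))] at h0
  have h1 := eq_zero_of_sum_component χ (v := fun g => partialD χ t (v (g * innGen t)))
    (fun g => by simpa using partialD_mem_component χ t (hv (g * innGen t))) h0
    (Finset.mem_univ (g * (innGen t)⁻¹))
  simpa using h1

theorem finrank_invariants_eq_sum [FiniteDimensional K (NicholsAlgebra χ)] [Fintype (Inn X)] :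
    Module.finrank K ↥(invariants χ Y) =
      ∑ g : Inn X, Module.finrank K ↥(component χ g ⊓ invariants χ Y) := by
  let f : (∀ g : Inn X, ↥(component χ g ⊓ invariants χ Y)) →ₗ[K] NicholsAlgebra χ :=
    ∑ g, (component χ g ⊓ invariants χ Y).subtype ∘ₗ LinearMap.proj g
  have hf : ∀ v, f v = ∑ g, (v g).1 := fun v => by simp [f]
  have hinj : Function.Injective f := by
    refine (injective_iff_map_eq_zero f).2 fun v hv => ?_
    rw [hf] at hv
    funext g
    exact Subtype.ext (eq_zero_of_sum_component χ (v := fun g => (v g).1)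
      (fun g => (v g).2.1) hv (Finset.mem_univ g))
  have hrange : LinearMap.range f = invariants χ Y := by
    refine le_antisymm ?_ fun v hv => ?_
    · rintro _ ⟨v, rfl⟩
      rw [hf]
      exact Submodule.sum_mem _ fun g _ => (v g).2.2
    · have hv' : v ∈ ⨆ g, component χ g := by rw [iSup_component]; trivial
      obtain ⟨w, hw, rfl⟩ := (Submodule.mem_iSup_iff_exists_finsupp _ _).1 hv'
      rw [Finsupp.sum_fintype _ _ (fun _ => rfl)] at hv ⊢
      exact ⟨fun g => ⟨w g, hw g, mem_invariants_of_sum_component hw hv g⟩, hf _⟩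
  rw [← LinearEquiv.finrank_eq (LinearEquiv.ofEq _ _ hrange),
    LinearMap.finrank_range_of_inj hinj, Module.finrank_pi_fintype]

theorem partialD_e_mul_of_ne {s t : X} (hst : s ≠ t) (v : NicholsAlgebra χ) :
    partialD χ t (e χ s * v) = e χ s * partialD χ t v := by
  rw [partialD_e_mul, Finsupp.single_eq_of_ne hst.symm, zero_smul, add_zero]

theorem e_mul_mem_invariants {s : X} (hs : s ∉ Y) {v : NicholsAlgebra χ}
    (hv : v ∈ invariants χ Y) : e χ s * v ∈ invariants χ Y := by
  refine mem_invariants.2 fun t ht => ?_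
  have hst : s ≠ t := fun h => hs (h ▸ ht)
  rw [partialD_e_mul_of_ne hst, mem_invariants.1 hv t ht, mul_zero]

theorem leftPartial_pow_mem_invariants (s : X) (k : ℕ) {v : NicholsAlgebra χ}
    (hv : v ∈ invariants χ Y) : (leftPartial χ s ^ k) v ∈ invariants χ Y := by
  induction k with
  | zero => exact hv
  | succ k ih =>
    refine mem_invariants.2 fun t ht => ?_
    rw [pow_succ', Module.End.mul_apply, ← leftPartial_partialD, mem_invariants.1 ih t ht,
      map_zero]

theorem leftPartial_pow_mem_component (s : X) (k : ℕ) {g : Inn X} {v : NicholsAlgebra χ}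
    (hv : v ∈ component χ g) :
    (leftPartial χ s ^ k) v ∈ component χ ((innGen s)⁻¹ ^ k * g) := by
  induction k with
  | zero => simpa using hv
  | succ k ih =>
    rw [pow_succ' (leftPartial χ s), Module.End.mul_apply, pow_succ' (innGen s)⁻¹, mul_assoc]
    exact leftPartial_mem_component χ s ih

end NicholsAlgebra

/-! ### Modules over the `q`-Weyl algebra -/

section QWeyl

variable {M : Type*} [AddCommGroup M] [Module K M] {q : K} {d f : Module.End K M}

/-- Used both for the injectivity of the shift operator and for the nilpotency of the left
derivations. -/
theorem qWeyl_pow (h : ∀ v, d (f v) = v + q • f (d v)) (k : ℕ) (v : M) :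
    (d ^ (k + 1)) (f v) =
      (∑ i ∈ Finset.range (k + 1), q ^ i) • (d ^ k) v + q ^ (k + 1) • f ((d ^ (k + 1)) v) := by
  induction k generalizing v with
  | zero => simp [h]
  | succ k ih =>
    rw [pow_succ, Module.End.mul_apply, h, map_add, map_smul, ih, geom_sum_succ (n := k + 1),
      ← Module.End.mul_apply (d ^ k), ← pow_succ, ← Module.End.mul_apply (d ^ (k + 1)) d,
      ← pow_succ, pow_succ' q (k + 1)]
    module

/-- In a module over the `q`-Weyl algebra on which both generators are nilpotent of the order
of `q`, the operator `f + d ^ (m - 1)` is injective. -/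
theorem qWeyl_shift_injective (h : ∀ v, d (f v) = v + q • f (d v)) (hq : q ≠ 0) {m : ℕ}
    (hm : 0 < m) (hqm : ∀ k, k + 1 < m → ∑ i ∈ Finset.range (k + 1), q ^ i ≠ 0)
    (hd : d ^ m = 0) (hf : f ^ m = 0) :
    Function.Injective (f + d ^ (m - 1) : Module.End K M) := by
  -- From here on `m` is one less than before: d^(m+1) = f^(m+1) = 0, and the operator is f + d^m.
  obtain ⟨m, rfl⟩ : ∃ n, m = n + 1 := ⟨m - 1, by omega⟩
  rw [Nat.add_sub_cancel]
  refine (injective_iff_map_eq_zero _).2 fun v hv => ?_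
  rw [LinearMap.add_apply] at hv
  have hdf : d (f v) = 0 := by
    have := congrArg d hv
    rwa [map_add, ← Module.End.mul_apply d (d ^ m), ← pow_succ', hd, LinearMap.zero_apply,
      add_zero, map_zero] at this
  -- As d(f v) = 0, `qWeyl_pow` makes f(d^(k+1) v) a multiple of d^k v, with a factor that is
  -- non-zero for k < m. Iteration undoes all k derivations.
  have key : ∀ k ≤ m, ∃ c : K, c ≠ 0 ∧ (f ^ k) ((d ^ k) v) = c • v := by
    intro k hk
    induction k with
    | zero => exact ⟨1, one_ne_zero, by simp⟩
    | succ k ih =>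
      obtain ⟨c, hc, hcv⟩ := ih (by omega)
      have hz : (d ^ (k + 1)) (f v) = 0 := by
        rw [pow_succ, Module.End.mul_apply, hdf, map_zero]
      have h1 : q ^ (k + 1) • f ((d ^ (k + 1)) v) =
          -((∑ i ∈ Finset.range (k + 1), q ^ i) • (d ^ k) v) := by
        rw [eq_neg_iff_add_eq_zero, add_comm, ← qWeyl_pow h, hz]
      have h2 : f ((d ^ (k + 1)) v) =
          (-(q ^ (k + 1))⁻¹ * ∑ i ∈ Finset.range (k + 1), q ^ i) • (d ^ k) v := by
        rw [← inv_smul_smul₀ (pow_ne_zero (k + 1) hq) (f _), h1]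
        module
      refine ⟨_, mul_ne_zero (mul_ne_zero (neg_ne_zero.2 (inv_ne_zero (pow_ne_zero (k + 1) hq)))
        (hqm k (by omega))) hc, ?_⟩
      rw [pow_succ, Module.End.mul_apply, h2, map_smul, hcv, smul_smul]
  obtain ⟨c, hc, hcv⟩ := key m le_rfl
  -- Applying f^m to f v + d^m v = 0 leaves only this term; compared with `key` at k = m it forces v
  -- = 0.
  have h0 : (f ^ m) ((d ^ m) v) = 0 := by
    have := congrArg (f ^ m) hv
    rwa [map_add, ← Module.End.mul_apply (f ^ m) f, ← pow_succ, hf, LinearMap.zero_apply,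
      zero_add, map_zero] at this
  rw [h0, eq_comm, smul_eq_zero] at hcv
  exact hcv.resolve_left hc

end QWeyl

end

section

variable {X K : Type*} [Quandle X] [Field K]

/-! ### The order of the cocycle -/

theorem toFun_act_act (χ : Cocycle X K) (t s : X) :
    χ.toFun (t ◃ s) (t ◃ s) = χ.toFun s s := by
  have h := χ.cocycle t s s
  rw [Quandle.fix, mul_comm] at h
  exact (mul_right_cancel h).symm

theorem toFun_smul_smul (χ : Cocycle X K) (g : Inn X) (s : X) :
    χ.toFun (g • s) (g • s) = χ.toFun s s := by
  obtain ⟨g, hg⟩ := g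
  change χ.toFun (g s) (g s) = χ.toFun s s
  induction hg using Subgroup.closure_induction generalizing s with
  | mem x hx =>
    obtain ⟨t, rfl⟩ := hx
    exact toFun_act_act χ t s
  | one => rfl
  | mul x y _ _ ihx ihy => exact (ihx (y s)).trans (ihy s)
  | inv x _ ih => simpa using (ih (x⁻¹ s)).symm

theorem orderOf_toFun (hind : Indecomposable X) (χ : Cocycle X K) (s : X) :
    orderOf (χ.toFun s s) = χ.order := by
  have h : (fun t : X => χ.toFun t t) = fun _ => χ.toFun s s := by
    funext t
    obtain ⟨g, rfl⟩ := hind.exists_smul_eq s t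
    exact toFun_smul_smul χ g s
  rw [Cocycle.order, h]
  exact (orderOf_injective (Pi.constMonoidHom X Kˣ)
    (fun a b hab => congrFun hab s) (χ.toFun s s)).symm

theorem pow_eq_one_of_geom_sum {q : Kˣ} {k : ℕ}
    (h : ∑ i ∈ Finset.range k, (q : K) ^ i = 0) : q ^ k = 1 := by
  have := geom_sum_mul (q : K) k
  rw [h, zero_mul, eq_comm, sub_eq_zero] at this
  exact Units.ext (by simpa using this)

/-- With its converse above, this makes the vanishing of q-integers independent of the
characteristic, provided q ≠ 1. -/
theorem geom_sum_eq_zero {q : Kˣ} (hq : q ≠ 1) {k : ℕ} (h : q ^ k = 1) :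
    ∑ i ∈ Finset.range k, (q : K) ^ i = 0 := by
  have h1 : (q : K) - 1 ≠ 0 := fun h => hq (Units.ext (sub_eq_zero.1 h))
  have h2 := geom_sum_mul (q : K) k
  rw [← Units.val_pow_eq_pow_val, h, Units.val_one, sub_self] at h2
  exact (mul_eq_zero.1 h2).resolve_right h1

/-- Makes the local nilpotency result for subracks available for a single derivation. -/
theorem isSubrack_singleton (s : X) : IsSubrack ({s} : Set X) := by
  rintro _ rfl _ rfl
  exact ⟨Quandle.fix, Quandle.fix_inv⟩

/-! ### Powers of e_s, nilpotency and the shift operator -/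

namespace NicholsAlgebra

variable (χ : Cocycle X K)

theorem act_e_pow (s : X) (k : ℕ) : act χ s (e χ s ^ k) = (χ.toFun s s : K) ^ k • e χ s ^ k := by
  induction k with
  | zero => simp
  | succ k ih =>
    rw [pow_succ, act_mul, ih, act_e, Quandle.fix, smul_mul_smul_comm, ← pow_succ]

theorem partialD_e_pow (t s : X) (k : ℕ) :
    partialD χ t (e χ s ^ (k + 1)) = Finsupp.single s (1 : K) t •
      (∑ i ∈ Finset.range (k + 1), (χ.toFun s s : K) ^ i) • e χ s ^ k := by
  induction k with
  | zero => simp [partialD_e]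
  | succ k ih =>
    rw [pow_succ' _ (k + 1), partialD_e_mul, ih, act_e_pow, mul_smul_comm, mul_smul_comm,
      ← pow_succ', Finset.sum_range_succ _ (k + 1), add_smul, smul_add]

theorem counit_e_pow (s : X) (k : ℕ) : counit χ (e χ s ^ (k + 1)) = 0 := by
  rw [pow_succ', counit_e_mul]

theorem e_pow_eq_zero {s : X} {m : ℕ} (hm : 0 < m)
    (h : ∑ i ∈ Finset.range m, (χ.toFun s s : K) ^ i = 0) : e χ s ^ m = 0 := by
  obtain ⟨m, rfl⟩ : ∃ n, m = n + 1 := ⟨m - 1, by omega⟩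
  refine eq_zero_of_partialD χ (counit_e_pow χ s m) fun t => ?_
  rw [partialD_e_pow, h, zero_smul, smul_zero]

theorem partialD_pow_e_pow (s : X) (k : ℕ) :
    (partialD χ s ^ k) (e χ s ^ k) =
      (∏ j ∈ Finset.range k, ∑ i ∈ Finset.range (j + 1), (χ.toFun s s : K) ^ i) • 1 := by
  induction k with
  | zero => simp
  | succ k ih =>
    rw [pow_succ (partialD χ s), Module.End.mul_apply, partialD_e_pow, Finsupp.single_eq_same,
      one_smul, map_smul, ih, smul_smul, Finset.prod_range_succ, mul_comm]

theorem exists_partialD_pow_eq_zero [FiniteDimensional K (NicholsAlgebra χ)] (s : X) :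
    ∃ N, partialD χ s ^ N = 0 := by
  have hv : ∀ v, ∃ i, ∀ k, i ≤ k → (partialD χ s ^ k) v = 0 := fun v => by
    obtain ⟨i, hi⟩ := exists_pow_apply_eq_zero (isSubrack_singleton s) v
    refine ⟨i, fun k hk => apply_eq_zero_of_le hk hi _ ?_⟩
    exact Submodule.pow_mem_pow _ (partialD_mem_derivSpan (Set.mem_singleton s)) k
  choose i hi using hv
  let b := Module.finBasis K (NicholsAlgebra χ)
  exact ⟨Finset.univ.sup fun j => i (b j), b.ext fun j =>
    hi (b j) _ (Finset.le_sup (f := fun j => i (b j)) (Finset.mem_univ j))⟩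

/-- The value 0 encodes infinite order. Since `∂_s` is nilpotent and `∂_s^N (e_s^N)` is the
q-factorial of N, some q-integer vanishes, so q = χ(s,s) is a root of unity. -/
theorem order_pos [FiniteDimensional K (NicholsAlgebra χ)] (hind : Indecomposable X) (s : X) :
    0 < χ.order := by
  obtain ⟨N, hD⟩ := exists_partialD_pow_eq_zero χ s
  have h := congrArg (counit χ) (partialD_pow_e_pow χ s N)
  rw [hD, LinearMap.zero_apply, map_zero, map_smul, counit_one, smul_eq_mul, mul_one, eq_comm,
    Finset.prod_eq_zero_iff] at h
  obtain ⟨j, -, hj⟩ := h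
  have h1 := pow_eq_one_of_geom_sum hj
  rw [← orderOf_toFun hind χ s]
  exact orderOf_pos_iff.2 (isOfFinOrder_iff_pow_eq_one.2 ⟨j + 1, j.succ_pos, h1⟩)

variable {χ}

theorem leftPartial_e_mul_self (s : X) (v : NicholsAlgebra χ) :
    leftPartial χ s (e χ s * v) = v + (χ.toFun s s : K) • (e χ s * leftPartial χ s v) := by
  have h := leftPartial_e_mul χ s s v
  rwa [Quandle.fix, Finsupp.single_eq_same, one_smul] at h

theorem leftPartial_pow_e_mul_of_ne {r u : X} (hru : r ≠ u) (k : ℕ) (v : NicholsAlgebra χ) :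
    (leftPartial χ (r ◃ u) ^ k) (e χ r * v) =
      (χ.toFun r u : K) ^ k • (e χ r * (leftPartial χ u ^ k) v) := by
  have hne : r ◃ u ≠ r := fun h => hru ((Rack.left_cancel r).1 (Quandle.fix.trans h.symm))
  induction k generalizing v with
  | zero => simp
  | succ k ih =>
    rw [pow_succ, Module.End.mul_apply, leftPartial_e_mul, Finsupp.single_eq_of_ne hne, zero_smul,
      zero_add, map_smul, ih, smul_smul, ← pow_succ', pow_succ (leftPartial χ u),
      Module.End.mul_apply]

/-- Left multiplication by e_r either satisfies the q-Weyl relation with the derivation (r = u) or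
commutes with it up to a scalar and the change of index from r ◃ u to u. Because of this change the
induction runs over all s at once. -/
theorem leftPartial_pow_eq_zero {m : ℕ} (hm : 0 < m)
    (h : ∀ s, ∑ i ∈ Finset.range m, (χ.toFun s s : K) ^ i = 0) (s : X) :
    leftPartial χ s ^ m = 0 := by
  obtain ⟨m, rfl⟩ : ∃ n, m = n + 1 := ⟨m - 1, by omega⟩
  ext v
  rw [LinearMap.zero_apply]
  induction v using induction generalizing s with
  | one => rw [pow_succ, Module.End.mul_apply, leftPartial_one, map_zero]
  | add v w hv hw => rw [map_add, hv, hw, add_zero]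
  | smul k v hv => rw [map_smul, hv, smul_zero]
  | mul r v hv =>
    obtain ⟨u, rfl⟩ : ∃ u, s = r ◃ u := ⟨r ◃⁻¹ s, by simp⟩
    by_cases hru : r = u
    · subst hru
      have h1 := qWeyl_pow (d := leftPartial χ r) (f := LinearMap.mulLeft K (e χ r))
        (leftPartial_e_mul_self r) m v
      rw [h, hv, zero_smul, map_zero, smul_zero, zero_add] at h1
      rw [Quandle.fix]
      exact h1
    · rw [leftPartial_pow_e_mul_of_ne hru, hv, mul_zero, smul_zero]

/-- The shift operator `e_s + (∂ᴸ_s) ^ (m - 1)` embeds the invariants of degree `g` into those of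
degree `g_s g`. -/
theorem finrank_component_le [FiniteDimensional K (NicholsAlgebra χ)] {Y : Set X} {s : X}
    (hs : s ∉ Y) (hind : Indecomposable X) (hq : χ.order ≠ 1) (hnm : degree X ∣ χ.order)
    (g : Inn X) :
    Module.finrank K ↥(component χ g ⊓ invariants χ Y) ≤
      Module.finrank K ↥(component χ (innGen s * g) ⊓ invariants χ Y) := by
  have hm := order_pos χ hind s
  have hne : ∀ t, χ.toFun t t ≠ 1 := fun t h => hq (by
    rw [← orderOf_toFun hind χ t, h, orderOf_one])
  have hsum : ∀ t, ∑ i ∈ Finset.range χ.order, (χ.toFun t t : K) ^ i = 0 := fun t => by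
    exact geom_sum_eq_zero (hne t) (by rw [← orderOf_toFun hind χ t, pow_orderOf_eq_one])
  have hinj := qWeyl_shift_injective (d := leftPartial χ s) (f := LinearMap.mulLeft K (e χ s))
    (leftPartial_e_mul_self s) (Units.ne_zero _) hm
    (fun k hk h => pow_ne_one_of_lt_orderOf k.succ_ne_zero
      ((orderOf_toFun hind χ s).symm ▸ hk) (pow_eq_one_of_geom_sum h))
    (leftPartial_pow_eq_zero hm hsum s)
    (by rw [LinearMap.pow_mulLeft, e_pow_eq_zero χ hm (hsum s), LinearMap.mulLeft_zero_eq_zero])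
  have hmaps : ∀ v ∈ component χ g ⊓ invariants χ Y,
      (LinearMap.mulLeft K (e χ s) + leftPartial χ s ^ (χ.order - 1) :
        Module.End K (NicholsAlgebra χ)) v ∈ component χ (innGen s * g) ⊓ invariants χ Y := by
    rintro v ⟨hvg, hvY⟩
    rw [LinearMap.add_apply, LinearMap.mulLeft_apply]
    refine Submodule.add_mem _ ⟨e_mul_mem_component χ s hvg, e_mul_mem_invariants hs hvY⟩
      ⟨?_, leftPartial_pow_mem_invariants s _ hvY⟩
    have h1 : innGen s ^ χ.order = 1 :=
      orderOf_dvd_iff_pow_eq_one.1 ((orderOf_innGen_eq_degree hind s).symm ▸ hnm)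
    -- Here n ∣ m enters: both summands of the operator shift the degree by the same g_s.
    have h2 : (innGen s)⁻¹ ^ (χ.order - 1) = innGen s := by
      rw [inv_pow, inv_eq_iff_mul_eq_one, ← pow_succ, Nat.sub_add_cancel hm, h1]
    have := leftPartial_pow_mem_component s (χ.order - 1) hvg
    rwa [h2] at this
  exact LinearMap.finrank_le_finrank_of_injective (f := LinearMap.restrict _ hmaps)
    (fun v w h => Subtype.ext (hinj (congrArg Subtype.val h)))

theorem finrank_component_eq [Finite X] [FiniteDimensional K (NicholsAlgebra χ)] {Y : Set X}
    (hind : Indecomposable X) (hq : χ.order ≠ 1) (hnm : degree X ∣ χ.order)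
    (hgen : Subgroup.closure (innGen '' Yᶜ) = (⊤ : Subgroup (Inn X))) (g : Inn X) :
    Module.finrank K ↥(component χ g ⊓ invariants χ Y) =
      Module.finrank K ↥(component χ 1 ⊓ invariants χ Y) := by
  have key : ∀ h g : Inn X, Module.finrank K ↥(component χ g ⊓ invariants χ Y) ≤
      Module.finrank K ↥(component χ (h * g) ⊓ invariants χ Y) := by
    intro h
    -- The inequalities only go from g to g_s g. In a finite group the generators already generate
    -- as a monoid, so no inverses are needed.
    have hh : h ∈ Submonoid.closure (innGen '' Yᶜ) := by
      rw [← Subgroup.closure_toSubmonoid_of_finite, hgen]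
      trivial
    induction hh using Submonoid.closure_induction with
    | mem x hx =>
      obtain ⟨s, hs, rfl⟩ := hx
      exact finrank_component_le hs hind hq hnm
    | one => intro g; rw [one_mul]
    | mul x y _ _ hx hy =>
      intro g
      rw [mul_assoc]
      exact (hy g).trans (hx (y * g))
  refine le_antisymm ?_ ?_
  · have := key g⁻¹ g
    rwa [inv_mul_cancel] at this
  · have := key g 1
    rwa [mul_one] at this

end NicholsAlgebra

/-- An indecomposable rack of degree one has at most one element. -/
theorem subsingleton_of_degree_eq_one (hind : Indecomposable X) (h : degree X = 1) :
    Subsingleton X := by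
  have hg : ∀ t : X, innGen t = 1 := fun t => by
    rw [← orderOf_eq_one_iff, orderOf_innGen_eq_degree hind, h]
  have hInn : Inn X = ⊥ := by
    refine Subgroup.closure_eq_bot_iff.2 ?_
    rintro _ ⟨t, rfl⟩
    exact congrArg Subtype.val (hg t)
  refine ⟨fun s t => ?_⟩
  obtain ⟨⟨g, hgI⟩, rfl⟩ := hind.exists_smul_eq s t
  rw [hInn, Subgroup.mem_bot] at hgI
  subst hgI
  rfl

end

end RackNichols
end

/-! ### The dimension formula -/

theorem mainTheorem1 {X K : Type*} [Quandle X] [Finite X] [Field K]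
    (hind : RackNichols.Indecomposable X) (hfaith : RackNichols.Faithful X)
    (χ : RackNichols.Cocycle X K)
    (hfin : FiniteDimensional K (RackNichols.NicholsAlgebra χ))
    (hnm : RackNichols.degree X ∣ χ.order)
    (X' : Set X) (hsub : RackNichols.IsSubrack X') (hne : X'.Nonempty) (hproper : X' ≠ Set.univ)
    (hgen : Subgroup.closure (RackNichols.innGen '' X'ᶜ) = (⊤ : Subgroup (RackNichols.Inn X))) :
    Module.finrank K (RackNichols.NicholsAlgebra χ) =
        Nat.card (RackNichols.Inn X) *
          Module.finrank K (RackNichols.NicholsAlgebra.sub χ X') *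
          Module.finrank K
            (RackNichols.NicholsAlgebra.component χ 1 ⊓
              ⨅ t ∈ X', LinearMap.ker (RackNichols.NicholsAlgebra.partialD χ t) :
                Submodule K (RackNichols.NicholsAlgebra χ)) ∧
      Nat.card (RackNichols.Inn X) * Module.finrank K (RackNichols.NicholsAlgebra.sub χ X') ∣
        Module.finrank K (RackNichols.NicholsAlgebra χ) := by
  open RackNichols NicholsAlgebra in
  have key : Module.finrank K (NicholsAlgebra χ) =
      Nat.card (Inn X) * Module.finrank K (sub χ X') *
        Module.finrank K ↥(component χ 1 ⊓ invariants χ X') := by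
    -- If m = 1, then n = 1 and X has at most one point, so it has no non-empty proper subset.
    have hq : χ.order ≠ 1 := fun h => by
      rw [h, Nat.dvd_one] at hnm
      have := subsingleton_of_degree_eq_one hind hnm
      exact hproper (Set.eq_univ_of_forall fun t => by
        obtain ⟨s, hs⟩ := hne
        rwa [Subsingleton.elim t s])
    have := Fintype.ofFinite (Inn X)
    rw [finrank_eq_finrank_invariants_mul hsub, finrank_invariants_eq_sum,
      Finset.sum_congr rfl fun g _ => finrank_component_eq hind hq hnm hgen g, Finset.sum_const,
      Finset.card_univ, smul_eq_mul, Nat.card_eq_fintype_card]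
    ring
  exact ⟨key, ⟨_, key⟩⟩
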